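/- **Setting (Unlabeled Pebble Motion on Trees).** The input is a tree $T=(V,E)$ with $n=|V|\ge 2$ nodes, given by neighbour lists, with $k$ pebbles on $k$ distinct nodes and with $k$ target nodes. A move takes one pebble from its node to an adjacent pebble-less node; a plan is a sequence of moves; a plan is feasible if it moves every pebble to a target. $\mathit{OPT}$ is the minimum length of a feasible plan. Root $T$ at an arbitrary node $r$; let $T_u$ be the subtree rooted at $u$, let $p(u)\in\{0,1\}$ be the current number of pebbles on $u$, and let the demand $d(u)$ be the number of targets minus the current number of pebbles in $T_u$. **Algorithm.** Compute $d$ by a postorder traversal of $T$, storing each child $v$ of each node $u$ in one of three linked lists at $u$, according to whether $d(v)>0$, $d(v)=0$ or $d(v)<0$; then call $\mathit{balance\_subtrees}(r)$. A child of $u$ of positive (negative) demand is always picked as the first node of the corresponding list. - $\mathit{balance\_subtrees}(u)$: while $u$ has a child of nonzero demand: if $p(u)=1$, pick a child $v$ with $d(v)>0$ and call $\mathit{inject\_pebble}(v)$; otherwise pick a child $v$ with $d(v)<0$ and call $\mathit{extract\_pebble}(v)$. Then call $\mathit{balance\_subtrees}(v)$ for every child $v$ of $u$. - $\mathit{inject\_pebble}(v)$,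 where $u$ is the parent of $v$: if $p(v)=1$, pick a child $w$ of $v$ with $d(w)>0$ and call $\mathit{inject\_pebble}(w)$. Then call $\mathit{move\_pebble}(u,v)$. - $\mathit{extract\_pebble}(v)$, where $u$ is the parent of $v$: if $p(v)=0$, pick a child $w$ of $v$ with $d(w)<0$ and call $\mathit{extract\_pebble}(w)$. Then call $\mathit{move\_pebble}(v,u)$. - $\mathit{move\_pebble}(a,b)$: set $p(a)\leftarrow 0$ and $p(b)\leftarrow 1$; if $b$ is a child of $a$ set $d(b)\leftarrow d(b)-1$, otherwise set $d(a)\leftarrow d(a)+1$; if the changed demand is now $0$, move that child from its list to the list of children of demand $0$; output the move $(a,b)$. **Cost model and encodings.** Running time is measured by logarithmic cost: every operation costs the number of bits of the integers and node references that it reads and writes (nodes are numbered $0,\dots,n-1$, so a reference costs $O(\log n)$); a procedure call is also charged for saving and restoring the local variables. In encodings a node reference takes $\lceil\log_2 n\rceil$ bits. The input is encoded by the self-delimiting neighbour list of every node together with one pebble bit and one target bit per node, and a plan by the two end nodes of each of its moves. **Theorem.** There is an absolute constant $C>0$ such that, for every such input with $n\ge 2$ and every choice of the root $r$, the algorithm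 terminates and outputs a feasible plan of length $\mathit{OPT}$, and 1. its total running time, including the computation of $d$, is at most $C\,(n\log n+\mathit{OPT}\log n)$; 2. its total running time is at most $C$ times the sum of the encoding sizes of the input and of the output plan; 3. the encoding size of the input is at most $C\,n\log n$, and that of the output plan is at most $C\cdot\mathit{OPT}\log n$. -/

import Mathlib

namespace UPMT

/-! ## Unlabeled pebble motion on trees -/

/-- `Moves G S plan S'`: starting with pebbles exactly on the nodes of `S`, the plan, a list of
moves `(a, b)`, can be executed in the graph `G` and leaves the pebbles exactly on `S'`.
A move takes one pebble from its node `a` to an adjacent node `b` without a pebble. -/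
inductive Moves {V : Type} [DecidableEq V] (G : SimpleGraph V) :
    Finset V → List (V × V) → Finset V → Prop
  | nil (S : Finset V) : Moves G S [] S
  | cons {S S' : Finset V} {a b : V} {plan : List (V × V)} :
      G.Adj a b → a ∈ S → b ∉ S → Moves G (insert b (S.erase a)) plan S' →
      Moves G S ((a, b) :: plan) S'

/-- An input of the problem: a tree on the nodes `0, …, n - 1`, given by neighbour lists (in any
order), the nodes that hold a pebble at the start, and as many target nodes. -/
structure Instance (n : ℕ) where
  graph : SimpleGraph (Fin n)
  isTree : graph.IsTree
  nbrs : Fin n → List (Fin n)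
  nodup_nbrs : ∀ x, (nbrs x).Nodup
  mem_nbrs : ∀ x y, y ∈ nbrs x ↔ graph.Adj x y
  start : Finset (Fin n)
  targets : Finset (Fin n)
  card_eq : start.card = targets.card

variable {n : ℕ}

/-- A feasible plan moves every pebble to a target. -/
def Instance.Feasible (I : Instance n) (plan : List (Fin n × Fin n)) : Prop :=
  ∃ S, Moves I.graph I.start plan S ∧ S ⊆ I.targets

/-- The least length of a feasible plan. -/
noncomputable def Instance.opt (I : Instance n) : ℕ :=
  sInf {m | ∃ plan, I.Feasible plan ∧ plan.length = m}

/-! ## Encodings -/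

/-- A reference to one of `n` nodes, written with `⌈log₂ n⌉` bits. -/
def encodeRef (x : Fin n) : List Bool :=
  List.ofFn fun j : Fin (Nat.clog 2 n) => (x : ℕ).testBit j

/-- For every node: its neighbours (each one preceded by the bit `1`, and the list closed by the
bit `0`), then one bit for "holds a pebble" and one bit for "is a target". -/
def encodeInput (I : Instance n) : List Bool :=
  (List.finRange n).flatMap fun x =>
    (I.nbrs x).flatMap (fun y => true :: encodeRef y) ++
      [false, decide (x ∈ I.start), decide (x ∈ I.targets)]

/-- For every move: its two end nodes. -/
def encodePlan (plan : List (Fin n × Fin n)) : List Bool :=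
  plan.flatMap fun m => encodeRef m.1 ++ encodeRef m.2

/-! ## An imperative language with logarithmic costs

Programs compute with integers. They use local variables, recursive procedures, global arrays of
integers, and global arrays of linked lists (accessed at the head only). The local variables of the
waiting procedures lie on a stack. Reading or writing an integer costs its number of bits; this
includes the integers used as indices, hence also the references to nodes. -/

/-- Names of local variables. -/
inductive Var
  | u | v | w | p
  deriving DecidableEq

instance : Fintype Var where
  elems := {.u, .v, .w, .p}
  complete x := by cases x <;> decide

/-- Names of global arrays of integers. -/
inductive Arr
  | pebble | target | demand | parent
  deriving DecidableEq

/-- Names of global arrays of lists: neighbours, children, and the children of positive, zero and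
negative demand. -/
inductive LArr
  | nbrs | child | pos | zero | neg
  deriving DecidableEq

/-- Names of procedures. -/
inductive Proc
  | computeDemand | balanceSubtrees | injectPebble | extractPebble | movePebble

inductive Expr
  | lit (z : ℤ)
  | var (x : Var)
  | add (e f : Expr)
  | sub (e f : Expr)
  | cell (a : Arr) (e : Expr)

inductive Cond
  | eq (e f : Expr)
  | lt (e f : Expr)
  | nonempty (L : LArr) (e : Expr)
  | or (c d : Cond)

inductive Stmt
  | skip
  | assign (x : Var) (e : Expr)
  | write (a : Arr) (e f : Expr)
  | head (x : Var) (L : LArr) (e : Expr)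
  | pop (x : Var) (L : LArr) (e : Expr)
  | push (L : LArr) (e f : Expr)
  | emit (e f : Expr)
  | seq (s t : Stmt)
  | ifte (c : Cond) (s t : Stmt)
  | loop (c : Cond) (s : Stmt)
  | call (q : Proc) (args : List (Var × Expr))

infixr:60 " ;; " => Stmt.seq

/-- The state of the machine: the local variables of the running procedure, the global memory, and
the output written so far (a list of moves). -/
structure State where
  loc : Var → ℤ
  mem : Arr → ℤ → ℤ
  lists : LArr → ℤ → List ℤ
  out : List (ℤ × ℤ)

namespace State

def setVar (σ : State) (x : Var) (z : ℤ) : State :=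
  { σ with loc := Function.update σ.loc x z }

def setCell (σ : State) (a : Arr) (i z : ℤ) : State :=
  { σ with mem := Function.update σ.mem a (Function.update (σ.mem a) i z) }

def setList (σ : State) (L : LArr) (i : ℤ) (l : List ℤ) : State :=
  { σ with lists := Function.update σ.lists L (Function.update (σ.lists L) i l) }

end State

/-- The number of bits of an integer, with a sign bit. -/
def bits (z : ℤ) : ℕ := Nat.size z.natAbs + 1

namespace Expr

def eval (σ : State) : Expr → ℤ
  | lit z => z
  | var x => σ.loc x
  | add e f => e.eval σ + f.eval σ
  | sub e f => e.eval σ - f.eval σ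
  | cell a e => σ.mem a (e.eval σ)

/-- Every subexpression costs the number of bits of its value. -/
def cost (σ : State) : Expr → ℕ
  | lit z => bits z
  | var x => bits (σ.loc x)
  | add e f => e.cost σ + f.cost σ + bits (e.eval σ + f.eval σ)
  | sub e f => e.cost σ + f.cost σ + bits (e.eval σ - f.eval σ)
  | cell a e => e.cost σ + bits (σ.mem a (e.eval σ))

end Expr

namespace Cond

def Holds (σ : State) : Cond → Prop
  | eq e f => e.eval σ = f.eval σ
  | lt e f => e.eval σ < f.eval σ
  | nonempty L e => σ.lists L (e.eval σ) ≠ []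
  | or c d => c.Holds σ ∨ d.Holds σ

def cost (σ : State) : Cond → ℕ
  | eq e f => e.cost σ + f.cost σ + 1
  | lt e f => e.cost σ + f.cost σ + 1
  | nonempty _ e => e.cost σ + 1
  | or c d => c.cost σ + d.cost σ + 1

end Cond

/-- The local variables of a called procedure: the arguments, and `0` for all other variables. -/
def newFrame (σ : State) (args : List (Var × Expr)) : Var → ℤ :=
  args.foldl (fun ρ a => Function.update ρ a.1 (a.2.eval σ)) fun _ => 0

/-- `Exec P s σ σ' t`: with the procedure bodies `P`, the statement `s` started in the state `σ`
terminates in the state `σ'`, at total cost `t`. A head access to an empty list has no rule: there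
the machine is stuck. -/
inductive Exec (P : Proc → Stmt) : Stmt → State → State → ℕ → Prop
  | skip (σ : State) : Exec P .skip σ σ 1
  | assign (x : Var) (e : Expr) (σ : State) :
      Exec P (.assign x e) σ (σ.setVar x (e.eval σ)) (e.cost σ + bits (e.eval σ))
  | write (a : Arr) (e f : Expr) (σ : State) :
      Exec P (.write a e f) σ (σ.setCell a (e.eval σ) (f.eval σ))
        (e.cost σ + f.cost σ + bits (f.eval σ))
  | head (x : Var) (L : LArr) (e : Expr) (σ : State) (y : ℤ) (l : List ℤ) :
      σ.lists L (e.eval σ) = y :: l →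
      Exec P (.head x L e) σ (σ.setVar x y) (e.cost σ + bits y)
  | pop (x : Var) (L : LArr) (e : Expr) (σ : State) (y : ℤ) (l : List ℤ) :
      σ.lists L (e.eval σ) = y :: l →
      Exec P (.pop x L e) σ ((σ.setList L (e.eval σ) l).setVar x y) (e.cost σ + bits y)
  | push (L : LArr) (e f : Expr) (σ : State) :
      Exec P (.push L e f) σ
        (σ.setList L (e.eval σ) (f.eval σ :: σ.lists L (e.eval σ)))
        (e.cost σ + f.cost σ + bits (f.eval σ))
  | emit (e f : Expr) (σ : State) :
      Exec P (.emit e f) σ { σ with out := σ.out ++ [(e.eval σ, f.eval σ)] }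
        (e.cost σ + f.cost σ + bits (e.eval σ) + bits (f.eval σ))
  | seq {s₁ s₂ : Stmt} {σ₁ σ₂ σ₃ : State} {t₁ t₂ : ℕ} :
      Exec P s₁ σ₁ σ₂ t₁ → Exec P s₂ σ₂ σ₃ t₂ → Exec P (.seq s₁ s₂) σ₁ σ₃ (t₁ + t₂)
  | ifTrue {c : Cond} {s₁ s₂ : Stmt} {σ σ' : State} {t : ℕ} :
      c.Holds σ → Exec P s₁ σ σ' t → Exec P (.ifte c s₁ s₂) σ σ' (c.cost σ + t)
  | ifFalse {c : Cond} {s₁ s₂ : Stmt} {σ σ' : State} {t : ℕ} :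
      ¬ c.Holds σ → Exec P s₂ σ σ' t → Exec P (.ifte c s₁ s₂) σ σ' (c.cost σ + t)
  | loopTrue {c : Cond} {s : Stmt} {σ₁ σ₂ σ₃ : State} {t₁ t₂ : ℕ} :
      c.Holds σ₁ → Exec P s σ₁ σ₂ t₁ → Exec P (.loop c s) σ₂ σ₃ t₂ →
      Exec P (.loop c s) σ₁ σ₃ (c.cost σ₁ + t₁ + t₂)
  | loopFalse {c : Cond} {s : Stmt} {σ : State} :
      ¬ c.Holds σ → Exec P (.loop c s) σ σ (c.cost σ)
  /- The caller's local variables are saved and restored, which is charged too. -/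
  | call {q : Proc} {args : List (Var × Expr)} {σ σ' : State} {t : ℕ} :
      Exec P (P q) { σ with loc := newFrame σ args } σ' t →
      Exec P (.call q args) σ { σ' with loc := σ.loc }
        ((args.map fun a => a.2.cost σ).sum + 2 * (∑ x, bits (σ.loc x)) + t)

/-- The final state and the running time are determined by the program and the initial state. -/
theorem Exec.unique {P : Proc → Stmt} {s : Stmt} {σ σ₁ σ₂ : State} {t₁ t₂ : ℕ}
    (h₁ : Exec P s σ σ₁ t₁) (h₂ : Exec P s σ σ₂ t₂) : σ₁ = σ₂ ∧ t₁ = t₂ := by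
  induction h₁ generalizing σ₂ t₂ with
  | skip | assign | write | push | emit => cases h₂; exact ⟨rfl, rfl⟩
  | head x L e σ y l h =>
    cases h₂ with
    | head _ _ _ _ y' l' h' => rw [h] at h'; cases h'; exact ⟨rfl, rfl⟩
  | pop x L e σ y l h =>
    cases h₂ with
    | pop _ _ _ _ y' l' h' => rw [h] at h'; cases h'; exact ⟨rfl, rfl⟩
  | seq _ _ ih₁ ih₂ =>
    cases h₂ with
    | seq a b =>
      obtain ⟨rfl, rfl⟩ := ih₁ a
      obtain ⟨rfl, rfl⟩ := ih₂ b
      exact ⟨rfl, rfl⟩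
  | ifTrue hc _ ih =>
    cases h₂ with
    | ifTrue _ a => obtain ⟨rfl, rfl⟩ := ih a; exact ⟨rfl, rfl⟩
    | ifFalse hc' _ => exact absurd hc hc'
  | ifFalse hc _ ih =>
    cases h₂ with
    | ifTrue hc' _ => exact absurd hc' hc
    | ifFalse _ a => obtain ⟨rfl, rfl⟩ := ih a; exact ⟨rfl, rfl⟩
  | loopTrue hc _ _ ih₁ ih₂ =>
    cases h₂ with
    | loopTrue _ a b =>
      obtain ⟨rfl, rfl⟩ := ih₁ a
      obtain ⟨rfl, rfl⟩ := ih₂ b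
      exact ⟨rfl, rfl⟩
    | loopFalse hc' => exact absurd hc hc'
  | loopFalse hc =>
    cases h₂ with
    | loopTrue hc' _ _ => exact absurd hc' hc
    | loopFalse _ => exact ⟨rfl, rfl⟩
  | call _ ih =>
    cases h₂ with
    | call a => obtain ⟨rfl, rfl⟩ := ih a; exact ⟨rfl, rfl⟩

/-! ## The algorithm -/

section Program

open UPMT.Expr UPMT.Cond UPMT.Stmt UPMT.Arr UPMT.LArr UPMT.Proc

/-- `movePebble(u, v)`: move a pebble from `u` to the adjacent node `v`, where one of `u`, `v` is
the parent of the other. If the demand of the child becomes `0`, then the child, which is the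
first node of its list, is moved to the list of children with demand `0`. -/
def movePebbleBody : Stmt :=
  write pebble (var .u) (lit 0) ;;
  write pebble (var .v) (lit 1) ;;
  ifte (.eq (cell parent (var .v)) (var .u))
    (write demand (var .v) (sub (cell demand (var .v)) (lit 1)) ;;
      ifte (.eq (cell demand (var .v)) (lit 0))
        (pop .w pos (var .u) ;;
          push zero (var .u) (var .w))
        skip)
    (write demand (var .u) (add (cell demand (var .u)) (lit 1)) ;;
      ifte (.eq (cell demand (var .u)) (lit 0))
        (pop .w neg (var .v) ;;
          push zero (var .v) (var .w))
        skip) ;;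
  emit (var .u) (var .v)

/-- `injectPebble(v)`: move a pebble from the parent `u` of `v` to `v`, after moving a pebble that
is on `v` further down. -/
def injectPebbleBody : Stmt :=
  assign .u (cell parent (var .v)) ;;
  ifte (.eq (cell pebble (var .v)) (lit 1))
    (head .w pos (var .v) ;;
      call injectPebble [(.v, var .w)])
    skip ;;
  call movePebble [(.u, var .u), (.v, var .v)]

/-- `extractPebble(v)`: move a pebble from `v` to the parent `u` of `v`, after fetching a pebble
from further down if there is none on `v`. -/
def extractPebbleBody : Stmt :=
  assign .u (cell parent (var .v)) ;;
  ifte (.eq (cell pebble (var .v)) (lit 0))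
    (head .w neg (var .v) ;;
      call extractPebble [(.v, var .w)])
    skip ;;
  call movePebble [(.u, var .v), (.v, var .u)]

/-- `balanceSubtrees(u)`: bring the demands of all children of `u` to `0`, then recurse on each
child. -/
def balanceSubtreesBody : Stmt :=
  loop (.or (nonempty pos (var .u)) (nonempty neg (var .u)))
    (ifte (.eq (cell pebble (var .u)) (lit 1))
      (head .v pos (var .u) ;;
        call injectPebble [(.v, var .v)])
      (head .v neg (var .u) ;;
        call extractPebble [(.v, var .v)])) ;;
  loop (nonempty child (var .u))
    (pop .v child (var .u) ;;
      call balanceSubtrees [(.u, var .v)])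

/-- `computeDemand(u, p)`: by a postorder traversal of the subtree of `u`, whose parent is `p`,
compute the demands (targets minus pebbles in the subtree), the parents and the lists of
children. -/
def computeDemandBody : Stmt :=
  write parent (var .u) (var .p) ;;
  write demand (var .u) (sub (cell target (var .u)) (cell pebble (var .u))) ;;
  loop (nonempty nbrs (var .u))
    (pop .v nbrs (var .u) ;;
      ifte (.eq (var .v) (var .p))
        skip
        (call computeDemand [(.u, var .v), (.p, var .u)] ;;
          write demand (var .u) (add (cell demand (var .u)) (cell demand (var .v))) ;;
          push child (var .u) (var .v) ;;
          ifte (.lt (lit 0) (cell demand (var .v)))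
            (push pos (var .u) (var .v))
            (ifte (.lt (cell demand (var .v)) (lit 0))
              (push neg (var .u) (var .v))
              (push zero (var .u) (var .v)))))

def program : Proc → Stmt
  | computeDemand => computeDemandBody
  | balanceSubtrees => balanceSubtreesBody
  | injectPebble => injectPebbleBody
  | extractPebble => extractPebbleBody
  | movePebble => movePebbleBody

/-- The whole algorithm, with the tree rooted at `r`; the parent of the root is recorded as `-1`. -/
def main (r : Fin n) : Stmt :=
  call computeDemand [(.u, lit ((r : ℕ) : ℤ)), (.p, lit (-1))] ;;
  call balanceSubtrees [(.u, lit ((r : ℕ) : ℤ))]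

end Program

/-- An array with the entries `f 0, …, f (n - 1)`, and the entry `d` elsewhere. -/
def tabulate {α : Type} (d : α) (f : Fin n → α) (i : ℤ) : α :=
  if h : 0 ≤ i ∧ i.toNat < n then f ⟨i.toNat, h.2⟩ else d

/-- The initial state: the memory holds the input and nothing else. -/
def load (I : Instance n) : State where
  loc _ := 0
  mem
    | .pebble => tabulate 0 fun x => if x ∈ I.start then 1 else 0
    | .target => tabulate 0 fun x => if x ∈ I.targets then 1 else 0
    | .demand => fun _ => 0
    | .parent => fun _ => 0
  lists
    | .nbrs => tabulate [] fun x => (I.nbrs x).map fun y => ((y : ℕ) : ℤ)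
    | _ => fun _ => []
  out := []

/-- `Runs I r plan t`: on the input `I`, with the tree rooted at `r`, the algorithm terminates at
total cost `t` and its output is the plan. -/
def Runs (I : Instance n) (r : Fin n) (plan : List (Fin n × Fin n)) (t : ℕ) : Prop :=
  ∃ σ, Exec program (main r) (load I) σ t ∧
    σ.out = plan.map fun m => (((m.1 : ℕ) : ℤ), ((m.2 : ℕ) : ℤ))

end UPMT

/-! Lower bound. Let `d v` be targets minus pebbles in the subtree of `v`. A move along the edge
between `v` and its parent changes `d v` by one and no other demand. A plan can only end with the
pebbles exactly on the targets, where all demands vanish, so every feasible plan has at least `∑ v,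
|d v|` moves (`IsDemand.sum_natAbs_le`).

Optimality. The algorithm only makes moves that bring a demand one step closer to zero, so its plan
has exactly `∑ v, |d v|` moves once all demands are zero. It never gets stuck because of the
recurrence `d u = target u - pebble u + ∑ d v` over the children: a pebbled `u` with `d u > 0`, or
with `d u = 0` and some unbalanced child, has a child of positive demand (`Consistent.exists_pos`),
and dually for an empty node (`Consistent.exists_neg`). By induction from the leaves,
`exec_injectPebble` and `exec_extractPebble` succeed; `balances` then clears the demands from the
root downwards, since a demand that is zero stays zero.

Running time. All integers that occur are at most `2 * n ^ 2` in absolute value, so each access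
costs at most `word n`. The potential `togo` is the sum of the absolute values of the stored
demands. Each call of `injectPebble` or `extractPebble` makes exactly one move itself, and the
resulting drop of `togo` pays for it; the rest is charged to the nodes, a constant number of words
each (`computes`, `balances`). Finally `word n = O(log n)`, and the input encoding has length of
order `n log n`.

The lists of children of demand zero are written but never read, so the invariants ignore them. -/

namespace UPMT

variable {n : ℕ}

/-! ## The rooted tree -/

namespace Instance

/-- In the tree rooted at `r`, the node `v` is a child of `u`. -/
def Child (I : Instance n) (r v u : Fin n) : Prop :=
  I.graph.Adj u v ∧ I.graph.dist r v = I.graph.dist r u + 1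

variable {I : Instance n} {r : Fin n}

theorem Child.adj {v u : Fin n} (h : I.Child r v u) : I.graph.Adj u v := h.1

theorem Child.dist {v u : Fin n} (h : I.Child r v u) :
    I.graph.dist r v = I.graph.dist r u + 1 := h.2

theorem Child.ne_root {v u : Fin n} (h : I.Child r v u) : v ≠ r := by
  rintro rfl
  have := h.dist
  simp at this

theorem Child.ne {v u : Fin n} (h : I.Child r v u) : v ≠ u := h.adj.ne'

/-- A shortest path from `r` to a parent of `v`, extended by the edge to `v`, has length equal to
the distance and hence is a path. Paths in a tree are unique, so the parent is always their
penultimate node. -/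
theorem Child.parent_unique {v u u' : Fin n} (h : I.Child r v u) (h' : I.Child r v u') :
    u = u' := by
  have key : ∀ w, I.Child r v w → ∀ p : I.graph.Walk r v, p.IsPath → w = p.penultimate := by
    intro w hw p hp
    obtain ⟨q, hq, hql⟩ := I.isTree.connected.exists_path_of_dist r w
    have hc : (q.concat hw.adj).IsPath := by
      apply SimpleGraph.Walk.isPath_of_length_eq_dist
      rw [SimpleGraph.Walk.length_concat, hql, hw.dist]
    obtain ⟨_, _, huniq⟩ := I.isTree.existsUnique_path r v
    rw [huniq p hp, ← huniq _ hc]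
    simp
  obtain ⟨p, hp, -⟩ := I.isTree.connected.exists_path_of_dist r v
  rw [key u h p hp, key u' h' p hp]

theorem child_or_child_of_adj {x y : Fin n} (r : Fin n) (h : I.graph.Adj x y) :
    I.Child r y x ∨ I.Child r x y := by
  rcases I.isTree.dist_eq_dist_add_one_of_adj r h with e | e
  · exact Or.inr ⟨h.symm, e⟩
  · exact Or.inl ⟨h, e⟩

theorem exists_parent {v : Fin n} (h : v ≠ r) : ∃ u, I.Child r v u := by
  obtain ⟨p, hp⟩ := I.isTree.connected.exists_walk_length_eq_dist r v
  have hnil : ¬ p.Nil := SimpleGraph.Walk.not_nil_of_ne h.symm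
  have hadj := p.adj_penultimate hnil
  refine ⟨p.penultimate, hadj, ?_⟩
  have h1 := SimpleGraph.dist_le p.dropLast
  have h2 : p.dropLast.length + 1 = p.length := SimpleGraph.Walk.length_dropLast_add_one hnil
  rcases I.isTree.dist_eq_dist_add_one_of_adj r hadj with e | e <;> omega

/-- Induction from the leaves of the rooted tree to the root. -/
theorem leaf_induction (I : Instance n) (r : Fin n) {P : Fin n → Prop}
    (h : ∀ u, (∀ v, I.Child r v u → P v) → P u) (u : Fin n) : P u := by
  obtain ⟨N, hN⟩ : ∃ N, ∀ x, I.graph.dist r x ≤ N :=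
    ⟨Finset.univ.sup (I.graph.dist r), fun x => Finset.le_sup (Finset.mem_univ x)⟩
  -- `k` bounds how far `u` lies above the maximal depth `N`; passing to a child lowers it by one.
  have key : ∀ k u, N ≤ I.graph.dist r u + k → P u := by
    intro k
    induction k with
    | zero =>
      intro u hu
      refine h u fun v hv => ?_
      have := hN v
      have := hv.dist
      omega
    | succ k ih =>
      intro u hu
      refine h u fun v hv => ih v ?_
      have := hv.dist
      omega
  exact key N u (by omega)

/-! ### Children and subtrees as finite sets -/

open Classical in
/-- The children of a node. -/
noncomputable def children (I : Instance n) (r u : Fin n) : Finset (Fin n) :=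
  Finset.univ.filter fun v => I.Child r v u

@[simp] theorem mem_children {v u : Fin n} : v ∈ I.children r u ↔ I.Child r v u := by
  simp [children]

open Classical in
/-- The nodes of the subtree rooted at a node. -/
noncomputable def subtree (I : Instance n) (r u : Fin n) : Finset (Fin n) :=
  Finset.univ.filter fun x => Relation.ReflTransGen (fun a b => I.Child r b a) u x

theorem mem_subtree_def {x u : Fin n} :
    x ∈ I.subtree r u ↔ Relation.ReflTransGen (fun a b => I.Child r b a) u x := by
  simp [subtree]

@[simp] theorem self_mem_subtree (u : Fin n) : u ∈ I.subtree r u :=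
  mem_subtree_def.2 .refl

theorem mem_subtree {x u : Fin n} :
    x ∈ I.subtree r u ↔ x = u ∨ ∃ v, I.Child r v u ∧ x ∈ I.subtree r v := by
  simp only [mem_subtree_def]
  rw [Relation.ReflTransGen.cases_head_iff]
  simp only [eq_comm]

theorem Child.subtree_subset {v u : Fin n} (h : I.Child r v u) :
    I.subtree r v ⊆ I.subtree r u := fun _ hx => mem_subtree.2 (Or.inr ⟨v, h, hx⟩)

theorem dist_le_of_mem_subtree {x u : Fin n} (h : x ∈ I.subtree r u) :
    I.graph.dist r u ≤ I.graph.dist r x := by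
  rw [mem_subtree_def] at h
  induction h with
  | refl => exact le_rfl
  | tail _ hc ih => have := hc.dist; omega

theorem Child.notMem_subtree {v u : Fin n} (h : I.Child r v u) : u ∉ I.subtree r v := by
  intro hu
  have := dist_le_of_mem_subtree hu
  have := h.dist
  omega

/-- Since parents are unique, the ancestors of `x` form a chain with one node per depth. This makes
the subtrees of siblings disjoint. -/
theorem eq_of_mem_subtree {x v w : Fin n} (hv : x ∈ I.subtree r v) (hw : x ∈ I.subtree r w)
    (h : I.graph.dist r v = I.graph.dist r w) : v = w := by
  rw [mem_subtree_def] at hv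
  induction hv with
  | refl =>
    rw [mem_subtree_def, Relation.ReflTransGen.cases_tail_iff] at hw
    rcases hw with rfl | ⟨y, hy, hc⟩
    · rfl
    · have := dist_le_of_mem_subtree (mem_subtree_def.2 hy)
      have := hc.dist
      omega
  | @tail y x hy hc ih =>
    have hvy := dist_le_of_mem_subtree (mem_subtree_def.2 hy)
    rw [mem_subtree_def, Relation.ReflTransGen.cases_tail_iff] at hw
    rcases hw with rfl | ⟨y', hy', hc'⟩
    · have := hc.dist
      omega
    · obtain rfl := hc.parent_unique hc'
      exact ih (mem_subtree_def.2 hy')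

theorem Child.eq_of_mem_subtree {x u v w : Fin n} (hv : I.Child r v u) (hw : I.Child r w u)
    (hxv : x ∈ I.subtree r v) (hxw : x ∈ I.subtree r w) : v = w :=
  Instance.eq_of_mem_subtree hxv hxw (by rw [hv.dist, hw.dist])

theorem subtree_root (x : Fin n) : x ∈ I.subtree r r := by
  have key : ∀ k x, I.graph.dist r x = k → x ∈ I.subtree r r := by
    intro k
    induction k with
    | zero =>
      intro x hx
      rw [I.isTree.connected.dist_eq_zero_iff] at hx
      simp [hx]
    | succ k ih =>
      intro x hx
      have hne : x ≠ r := by rintro rfl; simp at hx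
      obtain ⟨u, hu⟩ := exists_parent (I := I) hne
      have := ih u (by have := hu.dist; omega)
      rw [mem_subtree_def] at this ⊢
      exact this.tail hu
  exact key _ x rfl

/-- The subtree is the disjoint union of its root and the subtrees of the children. Both the demand
recurrence and the recurrence for subtree sizes, which drives the cost bounds, are instances. -/
theorem sum_subtree {M : Type*} [AddCommMonoid M] (f : Fin n → M) (u : Fin n) :
    ∑ x ∈ I.subtree r u, f x = f u + ∑ v ∈ I.children r u, ∑ x ∈ I.subtree r v, f x := by
  classical
  have h : I.subtree r u = insert u ((I.children r u).biUnion (I.subtree r)) := by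
    ext x
    rw [mem_subtree]
    simp
  rw [h, Finset.sum_insert, Finset.sum_biUnion]
  · intro v hv w hw hne
    rw [Function.onFun, Finset.disjoint_left]
    intro x hxv hxw
    exact hne (Child.eq_of_mem_subtree (by simpa using hv) (by simpa using hw) hxv hxw)
  · simp only [Finset.mem_biUnion, mem_children, not_exists, not_and]
    exact fun v hv => hv.notMem_subtree

theorem card_subtree (u : Fin n) :
    (I.subtree r u).card = 1 + ∑ v ∈ I.children r u, (I.subtree r v).card := by
  simp only [Finset.card_eq_sum_ones]
  exact sum_subtree (fun _ => 1) u

/-- Every node except the root is a child of exactly one node. -/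
theorem sum_sum_children {M : Type*} [AddCommMonoid M] (d : Fin n → M) :
    ∑ u, ∑ v ∈ I.children r u, d v = ∑ v ∈ Finset.univ.erase r, d v := by
  classical
  rw [← Finset.sum_biUnion]
  · congr 1
    ext v
    simp only [Finset.mem_biUnion, Finset.mem_univ, true_and, mem_children, Finset.mem_erase,
      and_true]
    exact ⟨fun ⟨_, h⟩ => h.ne_root, exists_parent⟩
  · intro u _ w _ hne
    rw [Function.onFun, Finset.disjoint_left]
    intro v hv hw
    exact hne (Child.parent_unique (by simpa using hv) (by simpa using hw))

/-! ## Demands -/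

/-- `d` is the demand of the subtrees when the pebbles are on `S`. -/
def IsDemand (I : Instance n) (r : Fin n) (S : Finset (Fin n)) (d : Fin n → ℤ) : Prop :=
  ∀ u, d u = (if u ∈ I.targets then 1 else 0) - (if u ∈ S then 1 else 0)
    + ∑ v ∈ I.children r u, d v

/-- Moving a pebble from `a` to its child `b`. -/
theorem IsDemand.move_down {S : Finset (Fin n)} {d : Fin n → ℤ} (h : I.IsDemand r S d)
    {a b : Fin n} (hc : I.Child r b a) (ha : a ∈ S) (hb : b ∉ S) :
    I.IsDemand r (insert b (S.erase a)) (Function.update d b (d b - 1)) := by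
  intro u
  -- Only the sum at `a` notices the changed demand of `b`, and there the lost pebble compensates
  -- it; so `d a`, and with it every demand other than that of `b`, stays valid.
  have hsum : ∑ v ∈ I.children r u, Function.update d b (d b - 1) v
      = ∑ v ∈ I.children r u, d v - if u = a then 1 else 0 := by
    by_cases hu : u = a
    · subst hu
      rw [Finset.sum_update_of_mem (by simpa using hc),
        ← Finset.sum_sdiff (s₁ := {b}) (s₂ := I.children r u) (by simpa using hc)]
      simp
      ring
    · have : b ∉ I.children r u := fun hb => hu (by simpa using (mem_children.1 hb).parent_unique hc)
      rw [Finset.sum_update_of_notMem this]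
      simp [hu]
  rw [hsum]
  have hu := h u
  have hne := hc.ne
  by_cases h1 : u = b
  · subst h1
    simp [hne, hb] at hu ⊢
    rw [hu]; ring
  · by_cases h2 : u = a
    · subst h2
      simp [h1, ha] at hu ⊢
      rw [hu]; ring
    · simp [h1, h2] at hu ⊢
      exact hu

/-- Moving a pebble from `a` to its parent `b`. -/
theorem IsDemand.move_up {S : Finset (Fin n)} {d : Fin n → ℤ} (h : I.IsDemand r S d)
    {a b : Fin n} (hc : I.Child r a b) (ha : a ∈ S) (hb : b ∉ S) :
    I.IsDemand r (insert b (S.erase a)) (Function.update d a (d a + 1)) := by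
  intro u
  have hsum : ∑ v ∈ I.children r u, Function.update d a (d a + 1) v
      = ∑ v ∈ I.children r u, d v + if u = b then 1 else 0 := by
    by_cases hu : u = b
    · subst hu
      rw [Finset.sum_update_of_mem (by simpa using hc),
        ← Finset.sum_sdiff (s₁ := {a}) (s₂ := I.children r u) (by simpa using hc)]
      simp
      ring
    · have : a ∉ I.children r u := fun hb => hu (by simpa using (mem_children.1 hb).parent_unique hc)
      rw [Finset.sum_update_of_notMem this]
      simp [hu]
  rw [hsum]
  have hu := h u
  have hne := hc.ne
  by_cases h1 : u = b
  · subst h1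
    simp [hne.symm, hb] at hu ⊢
    linarith
  · by_cases h2 : u = a
    · subst h2
      simp [h1, ha] at hu ⊢
      rw [hu]; ring
    · simp [h1, h2] at hu ⊢
      exact hu

/-! ### Final demands and the lower bound on the optimum -/

theorem IsDemand.eq_zero {d : Fin n → ℤ} (h : I.IsDemand r I.targets d) : d = 0 := by
  funext u
  refine I.leaf_induction r (P := fun u => d u = 0) (fun u ih => ?_) u
  rw [h u, Finset.sum_eq_zero fun v hv => ih v (by simpa using hv)]
  simp

theorem IsDemand.eq_targets {S : Finset (Fin n)} (h : I.IsDemand r S 0) : S = I.targets := by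
  ext u
  have := h u
  by_cases h1 : u ∈ S <;> by_cases h2 : u ∈ I.targets <;> simp_all

/-- Summing the recurrence over all nodes, every demand except that of the root cancels against its
occurrence as a child. -/
theorem IsDemand.root {S : Finset (Fin n)} {d : Fin n → ℤ} (h : I.IsDemand r S d)
    (hS : S.card = I.targets.card) : d r = 0 := by
  have h1 : ∑ u, d u = (I.targets.card : ℤ) - S.card + ∑ u, ∑ v ∈ I.children r u, d v := by
    rw [Finset.sum_congr rfl fun u _ => h u, Finset.sum_add_distrib, Finset.sum_sub_distrib]
    simp
  rw [sum_sum_children, hS, ← Finset.add_sum_erase _ d (Finset.mem_univ r)] at h1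
  linarith

/-- The sum of the absolute demands is a potential: a move changes a single demand by one, so it
lowers the sum by at most one, and the sum is zero at the end. -/
theorem IsDemand.sum_natAbs_le {S S' : Finset (Fin n)} {plan : List (Fin n × Fin n)}
    {d : Fin n → ℤ} (h : I.IsDemand r S d) (hm : Moves I.graph S plan S')
    (hS : S.card = I.targets.card) (hS' : S' ⊆ I.targets) :
    ∑ u, (d u).natAbs ≤ plan.length := by
  induction hm generalizing d with
  | nil S =>
    -- There are as many pebbles as targets, so pebbles that are all on targets cover them.
    obtain rfl := Finset.eq_of_subset_of_card_le hS' hS.ge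
    simp [h.eq_zero]
  | @cons S S' a b plan hadj ha hb _ ih =>
    have hcard : (insert b (S.erase a)).card = I.targets.card := by
      rw [Finset.card_insert_of_notMem (by simp [hb]), Finset.card_erase_of_mem ha, ← hS]
      have := Finset.card_pos.2 ⟨a, ha⟩
      omega
    have key : ∀ c z, (z = d c - 1 ∨ z = d c + 1) →
        ∑ u, (d u).natAbs ≤ ∑ u, (Function.update d c z u).natAbs + 1 := by
      intro c z hz
      rw [← Finset.add_sum_erase _ _ (Finset.mem_univ c),
        ← Finset.add_sum_erase _ (fun u => (Function.update d c z u).natAbs) (Finset.mem_univ c),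
        Finset.sum_congr rfl fun u hu => by
          rw [← Function.update_of_ne (Finset.ne_of_mem_erase hu) z d]]
      simp only [Function.update_self]
      omega
    rw [List.length_cons]
    rcases child_or_child_of_adj r hadj with hc | hc
    · have := ih (h.move_down hc ha hb) hcard hS'
      have := key b _ (Or.inl rfl)
      omega
    · have := ih (h.move_up hc ha hb) hcard hS'
      have := key a _ (Or.inr rfl)
      omega

/-- Targets minus pebbles in the subtree of `u`, at the start. -/
noncomputable def demand (I : Instance n) (r u : Fin n) : ℤ :=
  ∑ x ∈ I.subtree r u, ((if x ∈ I.targets then 1 else 0) - (if x ∈ I.start then 1 else 0))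

theorem isDemand_demand : I.IsDemand r I.start (I.demand r) := fun u => sum_subtree _ u

theorem natAbs_demand_le (u : Fin n) : (I.demand r u).natAbs ≤ n := by
  have h : |I.demand r u| ≤ ∑ x ∈ I.subtree r u, 1 :=
    (Finset.abs_sum_le_sum_abs _ _).trans (Finset.sum_le_sum fun x _ => by split_ifs <;> simp)
  have h2 := Finset.card_le_univ (I.subtree r u)
  simp at h h2
  rw [Int.abs_eq_natAbs] at h
  omega

theorem demand_root : I.demand r r = 0 := isDemand_demand.root I.card_eq

theorem sum_natAbs_demand_le_opt {plan : List (Fin n × Fin n)} (h : I.Feasible plan) :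
    ∑ u, (I.demand r u).natAbs ≤ plan.length := by
  obtain ⟨S, hm, hS⟩ := h
  exact isDemand_demand.sum_natAbs_le hm I.card_eq hS

theorem length_eq_opt {plan : List (Fin n × Fin n)} (h : I.Feasible plan)
    (hl : plan.length = ∑ u, (I.demand r u).natAbs) : plan.length = I.opt := by
  refine le_antisymm ?_ (Nat.sInf_le ⟨plan, h, rfl⟩)
  refine le_csInf ⟨_, plan, h, rfl⟩ ?_
  rintro m ⟨plan', h', rfl⟩
  exact hl ▸ sum_natAbs_demand_le_opt h'

end Instance

theorem Moves.append {V : Type} [DecidableEq V] {G : SimpleGraph V} {S S' S'' : Finset V}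
    {p q : List (V × V)} (h : Moves G S p S') (h' : Moves G S' q S'') :
    Moves G S (p ++ q) S'' := by
  induction h with
  | nil => exact h'
  | cons h1 h2 h3 _ ih => exact .cons h1 h2 h3 (ih h')

/-! ## Integers on the machine -/

/-- The integer by which the machine refers to a node. -/
def ref (x : Fin n) : ℤ := ((x : ℕ) : ℤ)

@[simp] theorem ref_inj {x y : Fin n} : ref x = ref y ↔ x = y := by
  simp [ref, Fin.ext_iff]

theorem ref_ne_neg_one (x : Fin n) : ref x ≠ -1 := by
  unfold ref; omega

/-- A bound on the number of bits of the integers that occur. -/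
def word (n : ℕ) : ℕ := Nat.size (2 * n ^ 2) + 1

theorem bits_le_word {z : ℤ} (h : z.natAbs ≤ 2 * n ^ 2) : bits z ≤ word n :=
  Nat.succ_le_succ (Nat.size_le_size h)

theorem bits_le_word_of_le {z : ℤ} (hn : 2 ≤ n) (h : z.natAbs ≤ n + 1) : bits z ≤ word n :=
  bits_le_word (h.trans (by nlinarith))

theorem bits_ref_le (x : Fin n) : bits (ref x) ≤ word n := by
  refine bits_le_word ?_
  have := x.2
  have : n ≤ n ^ 2 := Nat.le_self_pow (by norm_num) n
  simp only [ref, Int.natAbs_natCast]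
  omega

theorem bits_zero : bits 0 = 1 := by simp [bits]

theorem bits_one : bits 1 = 2 := by simp [bits]

theorem bits_neg_one : bits (-1) = 2 := by simp [bits]

/-- Lets literals and the unit costs of tests be absorbed into multiples of `word n`. -/
theorem four_le_word (hn : 2 ≤ n) : 4 ≤ word n := by
  have h : Nat.size 8 ≤ Nat.size (2 * n ^ 2) := Nat.size_le_size (by nlinarith)
  have : Nat.size 8 = 4 := by
    rw [show 8 = 2 ^ 3 by norm_num, Nat.size_pow]
  unfold word
  omega

/-- The list `l` enumerates the nodes with the property `P`. -/
def Enumerates (l : List ℤ) (P : Fin n → Prop) : Prop :=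
  ∃ l' : List (Fin n), l = l'.map ref ∧ l'.Nodup ∧ ∀ v, v ∈ l' ↔ P v

theorem Enumerates.congr {l : List ℤ} {P Q : Fin n → Prop} (h : Enumerates l P)
    (hPQ : ∀ v, P v ↔ Q v) : Enumerates l Q := by
  obtain ⟨l', h1, h2, h3⟩ := h
  exact ⟨l', h1, h2, fun v => (h3 v).trans (hPQ v)⟩

theorem Enumerates.nil {P : Fin n → Prop} (h : ∀ v, ¬ P v) : Enumerates [] P :=
  ⟨[], by simp, by simp, by simpa using h⟩

theorem Enumerates.cons {l : List ℤ} {P Q : Fin n → Prop} {x : Fin n} (h : Enumerates l P)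
    (hx : ¬ P x) (hPQ : ∀ v, Q v ↔ v = x ∨ P v) : Enumerates (ref x :: l) Q := by
  obtain ⟨l', rfl, h2, h3⟩ := h
  exact ⟨x :: l', by simp, by simp [h2, h3, hx], fun v => by simp [h3, hPQ]⟩

theorem Enumerates.tail {l : List ℤ} {P Q : Fin n → Prop} {x : Fin n}
    (h : Enumerates (ref x :: l) P) (hPQ : ∀ v, Q v ↔ v ≠ x ∧ P v) : Enumerates l Q := by
  obtain ⟨l', h1, h2, h3⟩ := h
  cases l' with
  | nil => simp at h1
  | cons y l' =>
    simp only [List.map_cons, List.cons.injEq, ref_inj] at h1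
    obtain ⟨rfl, rfl⟩ := h1
    rw [List.nodup_cons] at h2
    refine ⟨l', rfl, h2.2, fun v => ?_⟩
    rw [hPQ, ← h3, List.mem_cons]
    grind

/-- Guarantees that a head access succeeds once a suitable child is known to exist. The child found
at the head need not be that one, but it has the same property. -/
theorem Enumerates.exists_cons {l : List ℤ} {P : Fin n → Prop} (h : Enumerates l P)
    {x : Fin n} (hx : P x) : ∃ y l', l = ref y :: l' ∧ P y := by
  obtain ⟨l', rfl, h2, h3⟩ := h
  cases l' with
  | nil => simp [← h3] at hx
  | cons y l' => exact ⟨y, l'.map ref, by simp, (h3 y).1 (by simp)⟩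

theorem Enumerates.eq_nil_iff {l : List ℤ} {P : Fin n → Prop} (h : Enumerates l P) :
    l = [] ↔ ∀ v, ¬ P v := by
  obtain ⟨l', rfl, h2, h3⟩ := h
  simp [List.eq_nil_iff_forall_not_mem, h3]

/-! ## The state between two moves -/

/-- The nodes that hold a pebble. -/
def pebbled (n : ℕ) (σ : State) : Finset (Fin n) :=
  Finset.univ.filter fun x => σ.mem .pebble (ref x) = 1

@[simp] theorem mem_pebbled {σ : State} {x : Fin n} :
    x ∈ pebbled n σ ↔ σ.mem .pebble (ref x) = 1 := by simp [pebbled]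

/-- The stored demands. -/
def dem (n : ℕ) (σ : State) (x : Fin n) : ℤ := σ.mem .demand (ref x)

/-- The number of moves that are still necessary. -/
def togo (n : ℕ) (σ : State) : ℕ := ∑ x, (dem n σ x).natAbs

open Classical in
/-- The stored parent of a node. -/
noncomputable def parentRef (I : Instance n) (r v : Fin n) : ℤ :=
  if h : ∃ u, I.Child r v u then ref h.choose else -1

theorem Instance.Child.parentRef {I : Instance n} {r v u : Fin n} (h : I.Child r v u) :
    parentRef I r v = ref u := by
  have hex : ∃ u, I.Child r v u := ⟨u, h⟩
  rw [UPMT.parentRef, dif_pos hex, hex.choose_spec.parent_unique h]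

theorem parentRef_root (I : Instance n) (r : Fin n) : parentRef I r r = -1 := by
  rw [parentRef, dif_neg]
  rintro ⟨u, h⟩
  exact h.ne_root rfl

theorem child_of_parentRef {I : Instance n} {r v u : Fin n} (h : parentRef I r v = ref u) :
    I.Child r v u := by
  rw [parentRef] at h
  split_ifs at h with hex
  · rw [← ref_inj.1 h]; exact hex.choose_spec
  · exact absurd h.symm (ref_ne_neg_one u)

theorem bits_parentRef_le (hn : 2 ≤ n) (I : Instance n) (r v : Fin n) :
    bits (parentRef I r v) ≤ word n := by
  rw [parentRef]
  split_ifs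
  · exact bits_ref_le _
  · rw [bits_neg_one]
    have := four_le_word hn
    omega

/-- The memory describes the current pebbles, their demands and the lists of children with nonzero
demand. -/
structure Consistent (I : Instance n) (r : Fin n) (σ : State) : Prop where
  pebble : ∀ x : Fin n, σ.mem .pebble (ref x) = 0 ∨ σ.mem .pebble (ref x) = 1
  parent : ∀ x, σ.mem .parent (ref x) = parentRef I r x
  isDemand : I.IsDemand r (pebbled n σ) (dem n σ)
  le : ∀ x, (dem n σ x).natAbs ≤ n
  pos : ∀ u, Enumerates (σ.lists .pos (ref u)) fun v => I.Child r v u ∧ 0 < dem n σ v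
  neg : ∀ u, Enumerates (σ.lists .neg (ref u)) fun v => I.Child r v u ∧ dem n σ v < 0

/-- From `σ` to `σ'`, moves are carried out and put out, each of which is necessary. -/
structure Progress (I : Instance n) (r : Fin n) (σ σ' : State) : Prop where
  consistent : Consistent I r σ'
  plan : ∃ plan, Moves I.graph (pebbled n σ) plan (pebbled n σ') ∧
    σ'.out = σ.out ++ plan.map (fun m => (ref m.1, ref m.2)) ∧
    plan.length + togo n σ' = togo n σ
  zero : ∀ x, dem n σ x = 0 → dem n σ' x = 0

variable {I : Instance n} {r : Fin n}

theorem Consistent.setLoc {σ : State} (h : Consistent I r σ) (ρ : Var → ℤ) :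
    Consistent I r { σ with loc := ρ } := ⟨h.1, h.2, h.3, h.4, h.5, h.6⟩

theorem Consistent.refl {σ : State} (h : Consistent I r σ) : Progress I r σ σ :=
  ⟨h, ⟨[], .nil _, by simp, by simp⟩, fun _ => id⟩

theorem Progress.trans {σ σ' σ'' : State} (h : Progress I r σ σ') (h' : Progress I r σ' σ'') :
    Progress I r σ σ'' := by
  obtain ⟨p, h1, h2, h3⟩ := h.plan
  obtain ⟨q, h4, h5, h6⟩ := h'.plan
  exact ⟨h'.consistent, ⟨p ++ q, h1.append h4, by simp [h5, h2], by simp; omega⟩,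
    fun x hx => h'.zero x (h.zero x hx)⟩

theorem Progress.setLoc {σ σ' : State} (h : Progress I r σ σ') (ρ ρ' : Var → ℤ) :
    Progress I r { σ with loc := ρ } { σ' with loc := ρ' } :=
  ⟨h.1.setLoc ρ', h.2, h.3⟩

theorem togo_update {σ σ' : State} {b : Fin n} {z : ℤ}
    (h : dem n σ' = Function.update (dem n σ) b z) (hz : z.natAbs + 1 = (dem n σ b).natAbs) :
    togo n σ' + 1 = togo n σ := by
  unfold togo
  rw [← Finset.add_sum_erase _ _ (Finset.mem_univ b),
    ← Finset.add_sum_erase (f := fun x => (dem n σ x).natAbs) _ (Finset.mem_univ b),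
    Finset.sum_congr rfl fun u hu => by
      rw [h, Function.update_of_ne (Finset.ne_of_mem_erase hu)], h]
  simp only [Function.update_self]
  omega

/-! ### A single move -/

/-- The state after `movePebble` moved a pebble from `a` to `b`, where `c` is the lower of the two
nodes, its new demand is `z`, and the lists of nonzero demand have become `pos` and `neg`. -/
structure Moved (σ σ' : State) (a b c : Fin n) (z : ℤ) (pos neg : ℤ → List ℤ) : Prop where
  pebble : σ'.mem .pebble = Function.update (Function.update (σ.mem .pebble) (ref a) 0) (ref b) 1
  demand : σ'.mem .demand = Function.update (σ.mem .demand) (ref c) z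
  parent : σ'.mem .parent = σ.mem .parent
  pos : σ'.lists .pos = pos
  neg : σ'.lists .neg = neg
  child : σ'.lists .child = σ.lists .child
  out : σ'.out = σ.out ++ [(ref a, ref b)]

theorem Moved.dem {σ σ' : State} {a b c : Fin n} {z : ℤ} {pos neg : ℤ → List ℤ}
    (h : Moved σ σ' a b c z pos neg) : dem n σ' = Function.update (dem n σ) c z := by
  funext x
  simp [UPMT.dem, h.demand, Function.update_apply]

theorem Moved.pebbled {σ σ' : State} {a b c : Fin n} {z : ℤ} {pos neg : ℤ → List ℤ}
    (h : Moved σ σ' a b c z pos neg) :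
    pebbled n σ' = insert b ((pebbled n σ).erase a) := by
  ext x
  simp only [mem_pebbled, h.pebble, Finset.mem_insert, Finset.mem_erase, Function.update_apply,
    ref_inj]
  by_cases h1 : x = b <;> by_cases h2 : x = a <;> simp [h1, h2]

/-- The part of the invariant that is independent of the direction of the move. The direction enters
only through the new demand function and the two families of lists; `hz` says that the move is a
necessary one. -/
theorem Moved.progress {σ σ' : State} {a b c : Fin n} {z : ℤ} {pos neg : ℤ → List ℤ}
    (h : Moved σ σ' a b c z pos neg) (hσ : Consistent I r σ) (hadj : I.graph.Adj a b)
    (ha : σ.mem .pebble (ref a) = 1) (hb : σ.mem .pebble (ref b) = 0)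
    (hd : I.IsDemand r (insert b ((UPMT.pebbled n σ).erase a)) (Function.update (UPMT.dem n σ) c z))
    (hz : z.natAbs + 1 = (UPMT.dem n σ c).natAbs)
    (hpos : ∀ u, Enumerates (pos (ref u)) fun v =>
      I.Child r v u ∧ 0 < Function.update (UPMT.dem n σ) c z v)
    (hneg : ∀ u, Enumerates (neg (ref u)) fun v =>
      I.Child r v u ∧ Function.update (UPMT.dem n σ) c z v < 0) :
    Progress I r σ σ' where
  consistent := by
    refine ⟨fun x => ?_, fun x => ?_, ?_, fun x => ?_, fun u => ?_, fun u => ?_⟩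
    · rw [h.pebble]
      simp only [Function.update_apply]
      have := hσ.pebble x
      split_ifs <;> simp [this]
    · rw [h.parent, hσ.parent]
    · rw [h.pebbled, h.dem]; exact hd
    · rw [h.dem, Function.update_apply]
      split_ifs
      · have := hσ.le c
        omega
      · exact hσ.le x
    · rw [h.pos, h.dem]; exact hpos u
    · rw [h.neg, h.dem]; exact hneg u
  plan := ⟨[(a, b)], h.pebbled ▸ .cons hadj (by simpa using ha) (by simp [hb]) (.nil _),
    by simp [h.out], by have := togo_update h.dem hz; simp; omega⟩
  zero x hx := by
    rw [h.dem, Function.update_apply]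
    split_ifs with hxc
    · subst hxc; rw [hx] at hz; simp at hz
    · exact hx

/-- Lists are accessible at the head only, so `hl` is essential: it makes the `pop` remove `b`
itself when its demand reaches zero. -/
theorem exec_movePebble_down (hn : 2 ≤ n) {σ : State} (hσ : Consistent I r σ) {a b : Fin n}
    (hc : I.Child r b a) (hu : σ.loc .u = ref a) (hv : σ.loc .v = ref b) (hd : 0 < dem n σ b)
    {l : List ℤ} (hl : σ.lists .pos (ref a) = ref b :: l) :
    ∃ σ' t, Exec program movePebbleBody σ σ' t ∧ t ≤ 40 * word n ∧
      Moved σ σ' a b b (dem n σ b - 1)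
        (Function.update (σ.lists .pos) (ref a)
          (if dem n σ b - 1 = 0 then l else ref b :: l))
        (σ.lists .neg) := by
  have hpar := hσ.parent b
  rw [hc.parentRef] at hpar
  have h4 := four_le_word hn
  have hba := bits_ref_le a
  have hbb := bits_ref_le b
  have hle := hσ.le b
  have hbd : bits (dem n σ b) ≤ word n := bits_le_word_of_le hn (by omega)
  have hbd' : bits (dem n σ b - 1) ≤ word n := bits_le_word_of_le hn (by omega)
  unfold dem at *
  by_cases hz : σ.mem .demand (ref b) - 1 = 0
  · refine ⟨_, _, .seq (.write ..) (.seq (.write ..) (.seq (.ifTrue ?_ (.seq (.write ..)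
      (.ifTrue ?_ (.seq (.pop _ _ _ _ (ref b) l ?_) (.push ..))))) (.emit ..))), ?_, ?_⟩
    · simp [Cond.Holds, Expr.eval, State.setCell, hu, hv, hpar]
    · simpa [Cond.Holds, Expr.eval, State.setCell, hu, hv] using hz
    · simp [Expr.eval, State.setCell, hu, hv, hl]
    · simp [Cond.cost, Expr.cost, Expr.eval, State.setCell, State.setVar, State.setList, hu, hv,
        hpar, bits_zero, bits_one]
      omega
    · constructor <;>
      simp [Expr.eval, State.setCell, State.setVar, State.setList, hu, hv]
      rw [if_pos hz]
  · refine ⟨_, _, .seq (.write ..) (.seq (.write ..) (.seq (.ifTrue ?_ (.seq (.write ..)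
      (.ifFalse ?_ (.skip _)))) (.emit ..))), ?_, ?_⟩
    · simp [Cond.Holds, Expr.eval, State.setCell, hu, hv, hpar]
    · simpa [Cond.Holds, Expr.eval, State.setCell, hu, hv] using hz
    · simp [Cond.cost, Expr.cost, Expr.eval, State.setCell, hu, hv, hpar, bits_zero, bits_one]
      omega
    · constructor <;>
      simp [Expr.eval, State.setCell, hu, hv]
      rw [if_neg hz, hl]

theorem exec_movePebble_up (hn : 2 ≤ n) {σ : State} (hσ : Consistent I r σ) {a b : Fin n}
    (hc : I.Child r a b) (hu : σ.loc .u = ref a) (hv : σ.loc .v = ref b) (hd : dem n σ a < 0)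
    {l : List ℤ} (hl : σ.lists .neg (ref b) = ref a :: l) :
    ∃ σ' t, Exec program movePebbleBody σ σ' t ∧ t ≤ 40 * word n ∧
      Moved σ σ' a b a (dem n σ a + 1) (σ.lists .pos)
        (Function.update (σ.lists .neg) (ref b)
          (if dem n σ a + 1 = 0 then l else ref a :: l)) := by
  -- The program recognises the direction by this test; it fails also when `b` is the root, whose
  -- recorded parent is `-1`.
  have hpar : σ.mem .parent (ref b) ≠ ref a := by
    rw [hσ.parent b]
    intro h
    have := (child_of_parentRef h).dist
    have := hc.dist
    omega
  have h4 := four_le_word hn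
  have hba := bits_ref_le a
  have hbb := bits_ref_le b
  have hbp : bits (σ.mem .parent (ref b)) ≤ word n := by
    rw [hσ.parent b]; exact bits_parentRef_le hn I r b
  have hle := hσ.le a
  have hbd : bits (dem n σ a) ≤ word n := bits_le_word_of_le hn (by omega)
  have hbd' : bits (dem n σ a + 1) ≤ word n := bits_le_word_of_le hn (by omega)
  unfold dem at *
  by_cases hz : σ.mem .demand (ref a) + 1 = 0
  · refine ⟨_, _, .seq (.write ..) (.seq (.write ..) (.seq (.ifFalse ?_ (.seq (.write ..)
      (.ifTrue ?_ (.seq (.pop _ _ _ _ (ref a) l ?_) (.push ..))))) (.emit ..))), ?_, ?_⟩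
    · simp [Cond.Holds, Expr.eval, State.setCell, hu, hv, hpar]
    · simpa [Cond.Holds, Expr.eval, State.setCell, hu, hv] using hz
    · simp [Expr.eval, State.setCell, hu, hv, hl]
    · simp [Cond.cost, Expr.cost, Expr.eval, State.setCell, State.setVar, State.setList, hu, hv,
        bits_zero, bits_one]
      omega
    · constructor <;>
      simp [Expr.eval, State.setCell, State.setVar, State.setList, hu, hv]
      rw [if_pos hz]
  · refine ⟨_, _, .seq (.write ..) (.seq (.write ..) (.seq (.ifFalse ?_ (.seq (.write ..)
      (.ifFalse ?_ (.skip _)))) (.emit ..))), ?_, ?_⟩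
    · simp [Cond.Holds, Expr.eval, State.setCell, hu, hv, hpar]
    · simpa [Cond.Holds, Expr.eval, State.setCell, hu, hv] using hz
    · simp [Cond.cost, Expr.cost, Expr.eval, State.setCell, hu, hv, bits_zero, bits_one]
      omega
    · constructor <;>
      simp [Expr.eval, State.setCell, hu, hv]
      rw [if_neg hz, hl]

/-- The demand of `b` goes from positive to nonnegative, so `b` leaves the positive list of `a`
exactly when it becomes zero, and no negative list is affected. -/
theorem Moved.progress_down {σ σ' : State} {a b : Fin n} {l : List ℤ}
    (h : Moved σ σ' a b b (UPMT.dem n σ b - 1)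
      (Function.update (σ.lists .pos) (ref a)
        (if UPMT.dem n σ b - 1 = 0 then l else ref b :: l)) (σ.lists .neg))
    (hσ : Consistent I r σ) (hc : I.Child r b a)
    (ha : σ.mem .pebble (ref a) = 1) (hb : σ.mem .pebble (ref b) = 0) (hd : 0 < UPMT.dem n σ b)
    (hl : σ.lists .pos (ref a) = ref b :: l) : Progress I r σ σ' := by
  refine h.progress hσ hc.adj ha hb
    (hσ.isDemand.move_down hc (by simpa using ha) (by simp [hb])) (by omega) (fun u => ?_)
    fun u => (hσ.neg u).congr fun v => ?_
  · have hu := hσ.pos u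
    rw [Function.update_apply]
    split_ifs with h1 hz
    · obtain rfl := ref_inj.1 h1
      rw [hl] at hu
      refine hu.tail fun v => ?_
      by_cases hv : v = b
      · simp [hv, hz]
      · simp [hv]
    · obtain rfl := ref_inj.1 h1
      rw [hl] at hu
      refine hu.congr fun v => ?_
      by_cases hv : v = b
      · subst hv
        simp only [Function.update_self]
        exact and_congr_right fun _ => by omega
      · simp [hv]
    · refine hu.congr fun v => ?_
      by_cases hv : v = b
      · subst hv
        simp only [Function.update_self]
        have : ¬ I.Child r v u := fun hv => h1 (by rw [hc.parent_unique hv])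
        simp [this]
      · simp [hv]
  · by_cases hv : v = b
    · subst hv
      simp only [Function.update_self]
      exact and_congr_right fun _ => by omega
    · simp [hv]

theorem Moved.progress_up {σ σ' : State} {a b : Fin n} {l : List ℤ}
    (h : Moved σ σ' a b a (UPMT.dem n σ a + 1) (σ.lists .pos)
      (Function.update (σ.lists .neg) (ref b)
        (if UPMT.dem n σ a + 1 = 0 then l else ref a :: l)))
    (hσ : Consistent I r σ) (hc : I.Child r a b)
    (ha : σ.mem .pebble (ref a) = 1) (hb : σ.mem .pebble (ref b) = 0) (hd : UPMT.dem n σ a < 0)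
    (hl : σ.lists .neg (ref b) = ref a :: l) : Progress I r σ σ' := by
  refine h.progress hσ hc.adj.symm ha hb
    (hσ.isDemand.move_up hc (by simpa using ha) (by simp [hb])) (by omega)
    (fun u => (hσ.pos u).congr fun v => ?_) fun u => ?_
  · by_cases hv : v = a
    · subst hv
      simp only [Function.update_self]
      exact and_congr_right fun _ => by omega
    · simp [hv]
  · have hu := hσ.neg u
    rw [Function.update_apply]
    split_ifs with h1 hz
    · obtain rfl := ref_inj.1 h1
      rw [hl] at hu
      refine hu.tail fun v => ?_
      by_cases hv : v = a
      · simp [hv, hz]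
      · simp [hv]
    · obtain rfl := ref_inj.1 h1
      rw [hl] at hu
      refine hu.congr fun v => ?_
      by_cases hv : v = a
      · subst hv
        simp only [Function.update_self]
        exact and_congr_right fun _ => by omega
      · simp [hv]
    · refine hu.congr fun v => ?_
      by_cases hv : v = a
      · subst hv
        simp only [Function.update_self]
        have : ¬ I.Child r v u := fun hv => h1 (by rw [hc.parent_unique hv])
        simp [this]
      · simp [hv]

/-! ### Chains of moves -/

theorem sum_bits_loc_le {σ : State} (hloc : ∀ x, bits (σ.loc x) ≤ word n) :
    ∑ x, bits (σ.loc x) ≤ 4 * word n := by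
  refine (Finset.sum_le_card_nsmul _ _ _ fun x _ => hloc x).trans ?_
  rw [smul_eq_mul]
  -- The factor 4 is the number of local variables, found by evaluating the cardinality of `Var`.
  exact le_of_eq rfl

/-- The state of the nodes above depth `k`, the demands down to depth `k`, and all lists of
children, are the same. -/
structure SameAbove (I : Instance n) (r : Fin n) (k : ℕ) (σ σ' : State) : Prop where
  pebble : ∀ x, I.graph.dist r x < k → σ'.mem .pebble (ref x) = σ.mem .pebble (ref x)
  pos : ∀ x, I.graph.dist r x < k → σ'.lists .pos (ref x) = σ.lists .pos (ref x)
  neg : ∀ x, I.graph.dist r x < k → σ'.lists .neg (ref x) = σ.lists .neg (ref x)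
  demand : ∀ x, I.graph.dist r x ≤ k → σ'.mem .demand (ref x) = σ.mem .demand (ref x)
  child : σ'.lists .child = σ.lists .child

theorem SameAbove.trans {k k' : ℕ} {σ σ' σ'' : State} (h : SameAbove I r k σ σ')
    (h' : SameAbove I r k' σ' σ'') (hk : k' ≤ k) : SameAbove I r k' σ σ'' :=
  ⟨fun x hx => (h'.1 x hx).trans (h.1 x (by omega)),
    fun x hx => (h'.2 x hx).trans (h.2 x (by omega)),
    fun x hx => (h'.3 x hx).trans (h.3 x (by omega)),
    fun x hx => (h'.4 x hx).trans (h.4 x (by omega)), h'.5.trans h.5⟩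

theorem SameAbove.setLoc {k : ℕ} {σ σ' : State} (h : SameAbove I r k σ σ') (ρ ρ' : Var → ℤ) :
    SameAbove I r k { σ with loc := ρ } { σ' with loc := ρ' } := ⟨h.1, h.2, h.3, h.4, h.5⟩

/-- The common effect of `injectPebble` and `extractPebble` when the upper node of the last move is
`u`: afterwards the pebble state of `u` is `z`. -/
structure Shifted (I : Instance n) (r u : Fin n) (z : ℤ) (σ σ' : State) : Prop where
  progress : Progress I r σ σ'
  pebble : σ'.mem .pebble (ref u) = z
  same : SameAbove I r (I.graph.dist r u) σ σ'
  lt : togo n σ' < togo n σ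

theorem Shifted.setLoc {u : Fin n} {z : ℤ} {σ σ' : State} (h : Shifted I r u z σ σ')
    (ρ ρ' : Var → ℤ) : Shifted I r u z { σ with loc := ρ } { σ' with loc := ρ' } :=
  ⟨h.1.setLoc ρ ρ', h.2, h.3.setLoc ρ ρ', h.4⟩

theorem Moved.shifted_down {σ σ' : State} {a b : Fin n} {l : List ℤ}
    (h : Moved σ σ' a b b (UPMT.dem n σ b - 1)
      (Function.update (σ.lists .pos) (ref a)
        (if UPMT.dem n σ b - 1 = 0 then l else ref b :: l)) (σ.lists .neg))
    (hσ : Consistent I r σ) (hc : I.Child r b a)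
    (ha : σ.mem .pebble (ref a) = 1) (hb : σ.mem .pebble (ref b) = 0) (hd : 0 < UPMT.dem n σ b)
    (hl : σ.lists .pos (ref a) = ref b :: l) : Shifted I r a 0 σ σ' where
  progress := h.progress_down hσ hc ha hb hd hl
  pebble := by simp [h.pebble, hc.ne.symm]
  same := by
    have hdist := hc.dist
    refine ⟨fun x hx => ?_, fun x hx => ?_, fun x hx => by rw [h.neg], fun x hx => ?_, h.child⟩
    · have h1 : x ≠ a := by rintro rfl; omega
      have h2 : x ≠ b := by rintro rfl; omega
      simp [h.pebble, h1, h2]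
    · have h1 : x ≠ a := by rintro rfl; omega
      simp [h.pos, h1]
    · have h1 : x ≠ b := by rintro rfl; omega
      simp [h.demand, h1]
  lt := by have := togo_update h.dem (by omega); omega

theorem Moved.shifted_up {σ σ' : State} {a b : Fin n} {l : List ℤ}
    (h : Moved σ σ' a b a (UPMT.dem n σ a + 1) (σ.lists .pos)
      (Function.update (σ.lists .neg) (ref b)
        (if UPMT.dem n σ a + 1 = 0 then l else ref a :: l)))
    (hσ : Consistent I r σ) (hc : I.Child r a b)
    (ha : σ.mem .pebble (ref a) = 1) (hb : σ.mem .pebble (ref b) = 0) (hd : UPMT.dem n σ a < 0)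
    (hl : σ.lists .neg (ref b) = ref a :: l) : Shifted I r b 1 σ σ' where
  progress := h.progress_up hσ hc ha hb hd hl
  pebble := by simp [h.pebble]
  same := by
    have hdist := hc.dist
    refine ⟨fun x hx => ?_, fun x hx => by rw [h.pos], fun x hx => ?_, fun x hx => ?_, h.child⟩
    · have h1 : x ≠ a := by rintro rfl; omega
      have h2 : x ≠ b := by rintro rfl; omega
      simp [h.pebble, h1, h2]
    · have h1 : x ≠ b := by rintro rfl; omega
      simp [h.neg, h1]
    · have h1 : x ≠ a := by rintro rfl; omega
      simp [h.demand, h1]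
  lt := by have := togo_update h.dem (by omega); omega

/-- If all children had demand at most zero, the pebble on `u` would force `d u ≤ 0`, with `d u = 0`
only if every child has demand zero. The first alternative serves the recursion of `injectPebble`,
the second the loop of `balanceSubtrees`. -/
theorem Consistent.exists_pos {σ : State} (hσ : Consistent I r σ) {u : Fin n}
    (hp : σ.mem .pebble (ref u) = 1)
    (h : 0 < dem n σ u ∨ dem n σ u = 0 ∧ ∃ v, I.Child r v u ∧ dem n σ v ≠ 0) :
    ∃ v l, σ.lists .pos (ref u) = ref v :: l ∧ I.Child r v u ∧ 0 < dem n σ v := by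
  suffices ∃ v, I.Child r v u ∧ 0 < dem n σ v by
    obtain ⟨v, hv⟩ := this
    obtain ⟨y, l, h1, h2⟩ := (hσ.pos u).exists_cons hv
    exact ⟨y, l, h1, h2⟩
  by_contra! hneg
  have h1 := hσ.isDemand u
  rw [if_pos (mem_pebbled.2 hp)] at h1
  have h2 : ∑ v ∈ I.children r u, dem n σ v ≤ 0 :=
    Finset.sum_nonpos fun v hv => hneg v (by simpa using hv)
  rcases h with h | ⟨h, v, hv, hv0⟩
  · split_ifs at h1 <;> omega
  · have h3 : ∑ v ∈ I.children r u, dem n σ v = 0 := by split_ifs at h1 <;> omega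
    rw [Finset.sum_eq_zero_iff_of_nonpos fun v hv => hneg v (by simpa using hv)] at h3
    exact hv0 (h3 v (by simpa using hv))

/-- Dual to `Consistent.exists_pos`: without a pebble on `u` and without children of negative
demand, every term of the recurrence is nonnegative. -/
theorem Consistent.exists_neg {σ : State} (hσ : Consistent I r σ) {u : Fin n}
    (hp : σ.mem .pebble (ref u) = 0)
    (h : dem n σ u < 0 ∨ dem n σ u = 0 ∧ ∃ v, I.Child r v u ∧ dem n σ v ≠ 0) :
    ∃ v l, σ.lists .neg (ref u) = ref v :: l ∧ I.Child r v u ∧ dem n σ v < 0 := by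
  suffices ∃ v, I.Child r v u ∧ dem n σ v < 0 by
    obtain ⟨v, hv⟩ := this
    obtain ⟨y, l, h1, h2⟩ := (hσ.neg u).exists_cons hv
    exact ⟨y, l, h1, h2⟩
  by_contra! hneg
  have h1 := hσ.isDemand u
  rw [if_neg (show u ∉ pebbled n σ by simp [hp])] at h1
  have h2 : 0 ≤ ∑ v ∈ I.children r u, dem n σ v :=
    Finset.sum_nonneg fun v hv => hneg v (by simpa using hv)
  rcases h with h | ⟨h, v, hv, hv0⟩
  · split_ifs at h1 <;> omega
  · have h3 : ∑ v ∈ I.children r u, dem n σ v = 0 := by split_ifs at h1 <;> omega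
    rw [Finset.sum_eq_zero_iff_of_nonneg fun v hv => hneg v (by simpa using hv)] at h3
    exact hv0 (h3 v (by simpa using hv))

/-- The 50 words are 40 for the body, 2 for the arguments and 8 for saving and restoring four local
variables. -/
theorem call_movePebble_down (hn : 2 ≤ n) {σ : State} (hσ : Consistent I r σ) {a b : Fin n}
    (hc : I.Child r b a) {x y : Var} (hx : σ.loc x = ref a) (hy : σ.loc y = ref b)
    (hloc : ∀ x, bits (σ.loc x) ≤ word n)
    (ha : σ.mem .pebble (ref a) = 1) (hb : σ.mem .pebble (ref b) = 0) (hd : 0 < dem n σ b)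
    {l : List ℤ} (hl : σ.lists .pos (ref a) = ref b :: l) :
    ∃ σ' t, Exec program (.call .movePebble [(.u, .var x), (.v, .var y)]) σ σ' t ∧
      t ≤ 50 * word n ∧ Shifted I r a 0 σ σ' := by
  obtain ⟨σ', t, hex, ht, hm⟩ := exec_movePebble_down (a := a) (b := b) (l := l) hn
    (hσ.setLoc (newFrame σ [(.u, .var x), (.v, .var y)])) hc
    (by simp [newFrame, Expr.eval, hx]) (by simp [newFrame, Expr.eval, hy]) hd hl
  refine ⟨_, _, .call hex, ?_, ?_⟩
  · have := sum_bits_loc_le hloc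
    have := hloc x
    have := hloc y
    simp only [List.map_cons, List.map_nil, List.sum_cons, List.sum_nil, Expr.cost]
    omega
  · exact (hm.shifted_down (hσ.setLoc _) hc ha hb hd hl).setLoc σ.loc σ.loc

theorem call_movePebble_up (hn : 2 ≤ n) {σ : State} (hσ : Consistent I r σ) {a b : Fin n}
    (hc : I.Child r a b) {x y : Var} (hx : σ.loc x = ref a) (hy : σ.loc y = ref b)
    (hloc : ∀ x, bits (σ.loc x) ≤ word n)
    (ha : σ.mem .pebble (ref a) = 1) (hb : σ.mem .pebble (ref b) = 0) (hd : dem n σ a < 0)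
    {l : List ℤ} (hl : σ.lists .neg (ref b) = ref a :: l) :
    ∃ σ' t, Exec program (.call .movePebble [(.u, .var x), (.v, .var y)]) σ σ' t ∧
      t ≤ 50 * word n ∧ Shifted I r b 1 σ σ' := by
  obtain ⟨σ', t, hex, ht, hm⟩ := exec_movePebble_up (a := a) (b := b) (l := l) hn
    (hσ.setLoc (newFrame σ [(.u, .var x), (.v, .var y)])) hc
    (by simp [newFrame, Expr.eval, hx]) (by simp [newFrame, Expr.eval, hy]) hd hl
  refine ⟨_, _, .call hex, ?_, ?_⟩
  · have := sum_bits_loc_le hloc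
    have := hloc x
    have := hloc y
    simp only [List.map_cons, List.map_nil, List.sum_cons, List.sum_nil, Expr.cost]
    omega
  · exact (hm.shifted_up (hσ.setLoc _) hc ha hb hd hl).setLoc σ.loc σ.loc

theorem bits_newFrame_le {σ : State} {x y : Var} (hn : 2 ≤ n) (hloc : ∀ x, bits (σ.loc x) ≤ word n)
    (z : Var) : bits (newFrame σ [(x, .var y)] z) ≤ word n := by
  simp only [newFrame, List.foldl_cons, List.foldl_nil, Function.update_apply, Expr.eval]
  split_ifs
  · exact hloc y
  · rw [bits_zero]
    have := four_le_word hn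
    omega

theorem bits_update_le {ρ : Var → ℤ} {x : Var} {z : ℤ} (hρ : ∀ x, bits (ρ x) ≤ word n)
    (hz : bits z ≤ word n) (y : Var) : bits (Function.update ρ x z y) ≤ word n := by
  rw [Function.update_apply]
  split_ifs
  · exact hz
  · exact hρ y

theorem bits_pebble_le (hn : 2 ≤ n) {z : ℤ} (h : z = 0 ∨ z = 1) : bits z ≤ word n := by
  have := four_le_word hn
  rcases h with rfl | rfl
  · rw [bits_zero]; omega
  · rw [bits_one]; omega

/-- Passes from the body of a procedure to a call of it; the extra 9 words are one argument and the
saved and restored local variables. -/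
theorem call_of_shifted {u : Fin n} {q : Proc} {x : Var} {z : ℤ} {σ : State}
    (hloc : ∀ x, bits (σ.loc x) ≤ word n)
    (h : ∃ σ' t, Exec program (program q) { σ with loc := newFrame σ [(.v, .var x)] } σ' t ∧
      Shifted I r u z { σ with loc := newFrame σ [(.v, .var x)] } σ' ∧
      t + 100 * word n * togo n σ' ≤ 100 * word n * togo n σ) :
    ∃ σ' t, Exec program (.call q [(.v, .var x)]) σ σ' t ∧ σ'.loc = σ.loc ∧ Shifted I r u z σ σ' ∧
      t + 100 * word n * togo n σ' ≤ 100 * word n * togo n σ + 9 * word n := by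
  obtain ⟨σ', t, h1, h2, h3⟩ := h
  refine ⟨_, _, .call h1, rfl, h2.setLoc σ.loc σ.loc, ?_⟩
  have := sum_bits_loc_le hloc
  have := hloc x
  simp only [List.map_cons, List.map_nil, List.sum_cons, List.sum_nil, Expr.cost]
  change _ + 100 * word n * togo n σ' ≤ _
  omega

/-- Induction from the leaves, as the recursion descends to a child of `v`. The cost bound is
amortised: the final move lowers `togo` by at least one, which frees `100 * word n`, enough for the
call's own work and its call of `movePebble`. -/
theorem exec_injectPebble (hn : 2 ≤ n) (v : Fin n) : ∀ (u : Fin n) (σ : State),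
    Consistent I r σ → I.Child r v u → σ.loc .v = ref v → (∀ x, bits (σ.loc x) ≤ word n) →
    σ.mem .pebble (ref u) = 1 → 0 < dem n σ v → (∃ l, σ.lists .pos (ref u) = ref v :: l) →
    ∃ σ' t, Exec program injectPebbleBody σ σ' t ∧ Shifted I r u 0 σ σ' ∧
      t + 100 * word n * togo n σ' ≤ 100 * word n * togo n σ := by
  refine I.leaf_induction r (P := fun v => ∀ (u : Fin n) (σ : State),
    Consistent I r σ → I.Child r v u → σ.loc .v = ref v → (∀ x, bits (σ.loc x) ≤ word n) →
    σ.mem .pebble (ref u) = 1 → 0 < dem n σ v → (∃ l, σ.lists .pos (ref u) = ref v :: l) →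
    ∃ σ' t, Exec program injectPebbleBody σ σ' t ∧ Shifted I r u 0 σ σ' ∧
      t + 100 * word n * togo n σ' ≤ 100 * word n * togo n σ) ?_ v
  intro v ih u σ hσ hc hv hloc hpu hd ⟨l, hl⟩
  have hpar := hσ.parent v
  rw [hc.parentRef] at hpar
  have h4 := four_le_word hn
  have hbu := bits_ref_le u
  have hbv := bits_ref_le v
  have hbp := bits_pebble_le hn (hσ.pebble v)
  have hdist := hc.dist
  have hlt : I.graph.dist r u < I.graph.dist r v := by omega
  have hloc1 : ∀ x, bits (Function.update σ.loc .u (ref u) x) ≤ word n :=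
    bits_update_le hloc hbu
  have assign : Exec program (.assign .u (.cell .parent (.var .v))) σ
      { σ with loc := Function.update σ.loc .u (ref u) }
      (bits (ref v) + bits (ref u) + bits (ref u)) := by
    have := Exec.assign (P := program) .u (.cell .parent (.var .v)) σ
    simpa [Expr.eval, Expr.cost, hv, hpar, State.setVar] using this
  by_cases hp : σ.mem .pebble (ref v) = 1
  · obtain ⟨w, l', hl', hcw, hdw⟩ := hσ.exists_pos hp (Or.inl hd)
    have hbw := bits_ref_le w
    set σ₂ : State :=
      { σ with loc := Function.update (Function.update σ.loc .u (ref u)) .w (ref w) } with hσ₂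
    have hloc2 : ∀ x, bits (σ₂.loc x) ≤ word n := bits_update_le hloc1 hbw
    have head : Exec program (.head .w .pos (.var .v))
        { σ with loc := Function.update σ.loc .u (ref u) } σ₂ (bits (ref v) + bits (ref w)) := by
      have := Exec.head (P := program) .w .pos (.var .v)
        { σ with loc := Function.update σ.loc .u (ref u) } (ref w) l' (by simpa [Expr.eval, hv])
      simpa [Expr.cost, hv, State.setVar] using this
    obtain ⟨σ₃, t₃, h1, h2, h3, h5⟩ := call_of_shifted (u := v) (q := .injectPebble) (x := .w)
      hloc2 (ih w hcw v _ (hσ.setLoc (newFrame σ₂ [(.v, .var .w)])) hcw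
        (by simp [newFrame, Expr.eval, hσ₂]) (bits_newFrame_le hn hloc2) hp hdw ⟨l', hl'⟩)
    -- The recursive call only moves pebbles within the subtree of `v`, so it leaves `d v` alone;
    -- this is why `SameAbove` fixes demands down to and including its depth.
    have hdv : 0 < dem n σ₃ v := by
      rw [dem, h3.same.demand v le_rfl]
      exact hd
    -- `u` lies strictly above `v`, so it still has its pebble, and `v` is still the head of its
    -- positive list.
    obtain ⟨σ₄, t₄, h6, h7, h8⟩ := call_movePebble_down (x := .u) (y := .v) hn h3.1.1 hc
      (by simp [h2, hσ₂]) (by simp [h2, hσ₂, hv]) (by rw [h2]; exact hloc2)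
      ((h3.same.pebble u hlt).trans hpu) h3.pebble hdv ((h3.same.pos u hlt).trans hl)
    refine ⟨σ₄, _, .seq assign (.seq (.ifTrue ?_ (.seq head h1)) h6),
      ⟨(h3.1.setLoc σ.loc σ₃.loc).trans h8.1, h8.pebble,
        (h3.same.setLoc σ.loc σ₃.loc).trans h8.same hlt.le, h8.lt.trans h3.lt⟩, ?_⟩
    · simp [Cond.Holds, Expr.eval, hv, hp]
    · have h9 : 100 * word n * togo n σ₄ + 100 * word n ≤ 100 * word n * togo n σ₃ := by
        rw [← Nat.mul_succ]
        exact Nat.mul_le_mul_left _ h8.lt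
      change _ ≤ 100 * word n * togo n σ + 9 * word n at h5
      simp [Cond.cost, Expr.cost, Expr.eval, hv, bits_one]
      omega
  · have hp' := (hσ.pebble v).resolve_right hp
    obtain ⟨σ₄, t₄, h6, h7, h8⟩ := call_movePebble_down (x := .u) (y := .v) hn
      (hσ.setLoc (Function.update σ.loc .u (ref u))) hc (by simp) (by simp [hv]) hloc1 hpu hp' hd hl
    refine ⟨σ₄, _, .seq assign (.seq (.ifFalse ?_ (.skip _)) h6), h8.setLoc σ.loc σ₄.loc, ?_⟩
    · simp [Cond.Holds, Expr.eval, hv, hp]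
    · have h9 : 100 * word n * togo n σ₄ + 100 * word n ≤ 100 * word n * togo n σ := by
        rw [← Nat.mul_succ]
        exact Nat.mul_le_mul_left _ h8.lt
      simp [Cond.cost, Expr.cost, Expr.eval, hv, bits_one]
      omega

/-- Mirror image of `exec_injectPebble`, with the roles of pebbles and empty nodes exchanged: the
recursion now puts a pebble on `v` before the move to `u`. -/
theorem exec_extractPebble (hn : 2 ≤ n) (v : Fin n) : ∀ (u : Fin n) (σ : State),
    Consistent I r σ → I.Child r v u → σ.loc .v = ref v → (∀ x, bits (σ.loc x) ≤ word n) →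
    σ.mem .pebble (ref u) = 0 → dem n σ v < 0 → (∃ l, σ.lists .neg (ref u) = ref v :: l) →
    ∃ σ' t, Exec program extractPebbleBody σ σ' t ∧ Shifted I r u 1 σ σ' ∧
      t + 100 * word n * togo n σ' ≤ 100 * word n * togo n σ := by
  refine I.leaf_induction r (P := fun v => ∀ (u : Fin n) (σ : State),
    Consistent I r σ → I.Child r v u → σ.loc .v = ref v → (∀ x, bits (σ.loc x) ≤ word n) →
    σ.mem .pebble (ref u) = 0 → dem n σ v < 0 → (∃ l, σ.lists .neg (ref u) = ref v :: l) →
    ∃ σ' t, Exec program extractPebbleBody σ σ' t ∧ Shifted I r u 1 σ σ' ∧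
      t + 100 * word n * togo n σ' ≤ 100 * word n * togo n σ) ?_ v
  intro v ih u σ hσ hc hv hloc hpu hd ⟨l, hl⟩
  have hpar := hσ.parent v
  rw [hc.parentRef] at hpar
  have h4 := four_le_word hn
  have hbu := bits_ref_le u
  have hbv := bits_ref_le v
  have hbp := bits_pebble_le hn (hσ.pebble v)
  have hdist := hc.dist
  have hlt : I.graph.dist r u < I.graph.dist r v := by omega
  have hloc1 : ∀ x, bits (Function.update σ.loc .u (ref u) x) ≤ word n :=
    bits_update_le hloc hbu
  have assign : Exec program (.assign .u (.cell .parent (.var .v))) σ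
      { σ with loc := Function.update σ.loc .u (ref u) }
      (bits (ref v) + bits (ref u) + bits (ref u)) := by
    have := Exec.assign (P := program) .u (.cell .parent (.var .v)) σ
    simpa [Expr.eval, Expr.cost, hv, hpar, State.setVar] using this
  by_cases hp : σ.mem .pebble (ref v) = 0
  · obtain ⟨w, l', hl', hcw, hdw⟩ := hσ.exists_neg hp (Or.inl hd)
    have hbw := bits_ref_le w
    set σ₂ : State :=
      { σ with loc := Function.update (Function.update σ.loc .u (ref u)) .w (ref w) } with hσ₂
    have hloc2 : ∀ x, bits (σ₂.loc x) ≤ word n := bits_update_le hloc1 hbw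
    have head : Exec program (.head .w .neg (.var .v))
        { σ with loc := Function.update σ.loc .u (ref u) } σ₂ (bits (ref v) + bits (ref w)) := by
      have := Exec.head (P := program) .w .neg (.var .v)
        { σ with loc := Function.update σ.loc .u (ref u) } (ref w) l' (by simpa [Expr.eval, hv])
      simpa [Expr.cost, hv, State.setVar] using this
    obtain ⟨σ₃, t₃, h1, h2, h3, h5⟩ := call_of_shifted (u := v) (q := .extractPebble) (x := .w)
      hloc2 (ih w hcw v _ (hσ.setLoc (newFrame σ₂ [(.v, .var .w)])) hcw
        (by simp [newFrame, Expr.eval, hσ₂]) (bits_newFrame_le hn hloc2) hp hdw ⟨l', hl'⟩)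
    have hdv : dem n σ₃ v < 0 := by
      rw [dem, h3.same.demand v le_rfl]
      exact hd
    obtain ⟨σ₄, t₄, h6, h7, h8⟩ := call_movePebble_up (x := .v) (y := .u) hn h3.1.1 hc
      (by simp [h2, hσ₂, hv]) (by simp [h2, hσ₂]) (by rw [h2]; exact hloc2)
      h3.pebble ((h3.same.pebble u hlt).trans hpu) hdv ((h3.same.neg u hlt).trans hl)
    refine ⟨σ₄, _, .seq assign (.seq (.ifTrue ?_ (.seq head h1)) h6),
      ⟨(h3.1.setLoc σ.loc σ₃.loc).trans h8.1, h8.pebble,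
        (h3.same.setLoc σ.loc σ₃.loc).trans h8.same hlt.le, h8.lt.trans h3.lt⟩, ?_⟩
    · simp [Cond.Holds, Expr.eval, hv, hp]
    · have h9 : 100 * word n * togo n σ₄ + 100 * word n ≤ 100 * word n * togo n σ₃ := by
        rw [← Nat.mul_succ]
        exact Nat.mul_le_mul_left _ h8.lt
      change _ ≤ 100 * word n * togo n σ + 9 * word n at h5
      simp [Cond.cost, Expr.cost, Expr.eval, hv, bits_zero]
      omega
  · have hp' := (hσ.pebble v).resolve_left hp
    obtain ⟨σ₄, t₄, h6, h7, h8⟩ := call_movePebble_up (x := .v) (y := .u) hn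
      (hσ.setLoc (Function.update σ.loc .u (ref u))) hc (by simp [hv]) (by simp) hloc1 hp' hpu hd hl
    refine ⟨σ₄, _, .seq assign (.seq (.ifFalse ?_ (.skip _)) h6), h8.setLoc σ.loc σ₄.loc, ?_⟩
    · simp [Cond.Holds, Expr.eval, hv, hp]
    · have h9 : 100 * word n * togo n σ₄ + 100 * word n ≤ 100 * word n * togo n σ := by
        rw [← Nat.mul_succ]
        exact Nat.mul_le_mul_left _ h8.lt
      simp [Cond.cost, Expr.cost, Expr.eval, hv, bits_zero]
      omega

/-! ### Balancing -/

theorem exec_balance_step (hn : 2 ≤ n) {u : Fin n} {σ : State} (hσ : Consistent I r σ)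
    (hu : σ.loc .u = ref u) (hloc : ∀ x, bits (σ.loc x) ≤ word n) (h0 : dem n σ u = 0)
    (hne : ∃ v, I.Child r v u ∧ dem n σ v ≠ 0) :
    ∃ σ' t, Exec program (.ifte (.eq (.cell .pebble (.var .u)) (.lit 1))
      (.head .v .pos (.var .u) ;; .call .injectPebble [(.v, .var .v)])
      (.head .v .neg (.var .u) ;; .call .extractPebble [(.v, .var .v)])) σ σ' t ∧
      Progress I r σ σ' ∧ σ'.loc .u = ref u ∧ (∀ x, bits (σ'.loc x) ≤ word n) ∧
      σ'.lists .child = σ.lists .child ∧ togo n σ' < togo n σ ∧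
      t + 100 * word n * togo n σ' ≤ 100 * word n * togo n σ + 15 * word n := by
  have h4 := four_le_word hn
  have hbu := bits_ref_le u
  have hbp := bits_pebble_le hn (hσ.pebble u)
  by_cases hp : σ.mem .pebble (ref u) = 1
  · obtain ⟨v, l, hl, hc, hd⟩ := hσ.exists_pos hp (Or.inr ⟨h0, hne⟩)
    have hbv := bits_ref_le v
    have head := Exec.head (P := program) .v .pos (.var .u) σ (ref v) l (by simpa [Expr.eval, hu])
    have hloc1 : ∀ x, bits ((σ.setVar .v (ref v)).loc x) ≤ word n := bits_update_le hloc hbv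
    obtain ⟨σ', t, h1, h2, h3, h5⟩ := call_of_shifted (u := u) (q := .injectPebble) (x := .v)
      hloc1 (exec_injectPebble hn v u _ (hσ.setLoc (newFrame (σ.setVar .v (ref v)) [(.v, .var .v)]))
        hc (by simp [newFrame, Expr.eval, State.setVar]) (bits_newFrame_le hn hloc1) hp hd ⟨l, hl⟩)
    refine ⟨σ', _, .ifTrue ?_ (.seq head h1), h3.1.setLoc σ.loc σ'.loc, ?_, ?_, h3.same.child,
      h3.lt, ?_⟩
    · simp [Cond.Holds, Expr.eval, hu, hp]
    · simp [h2, State.setVar, hu]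
    · rw [h2]; exact hloc1
    · change _ ≤ 100 * word n * togo n σ + 9 * word n at h5
      simp [Cond.cost, Expr.cost, Expr.eval, hu, bits_one]
      omega
  · obtain ⟨v, l, hl, hc, hd⟩ :=
      hσ.exists_neg ((hσ.pebble u).resolve_right hp) (Or.inr ⟨h0, hne⟩)
    have hbv := bits_ref_le v
    have head := Exec.head (P := program) .v .neg (.var .u) σ (ref v) l (by simpa [Expr.eval, hu])
    have hloc1 : ∀ x, bits ((σ.setVar .v (ref v)).loc x) ≤ word n := bits_update_le hloc hbv
    obtain ⟨σ', t, h1, h2, h3, h5⟩ := call_of_shifted (u := u) (q := .extractPebble) (x := .v)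
      hloc1 (exec_extractPebble hn v u _
        (hσ.setLoc (newFrame (σ.setVar .v (ref v)) [(.v, .var .v)])) hc
        (by simp [newFrame, Expr.eval, State.setVar]) (bits_newFrame_le hn hloc1)
        ((hσ.pebble u).resolve_right hp) hd ⟨l, hl⟩)
    refine ⟨σ', _, .ifFalse ?_ (.seq head h1), h3.1.setLoc σ.loc σ'.loc, ?_, ?_, h3.same.child,
      h3.lt, ?_⟩
    · simp [Cond.Holds, Expr.eval, hu, hp]
    · simp [h2, State.setVar, hu]
    · rw [h2]; exact hloc1
    · change _ ≤ 100 * word n * togo n σ + 9 * word n at h5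
      simp [Cond.cost, Expr.cost, Expr.eval, hu, bits_one]
      omega

/-- Strong induction on `togo`, which every iteration decreases. The demand of `u` stays zero, so as
long as some child is unbalanced the next iteration finds one of the required sign. -/
theorem exec_balance_loop (hn : 2 ≤ n) {u : Fin n} (m : ℕ) : ∀ {σ : State}, togo n σ = m →
    Consistent I r σ → σ.loc .u = ref u → (∀ x, bits (σ.loc x) ≤ word n) → dem n σ u = 0 →
    ∃ σ' t, Exec program (.loop (.or (.nonempty .pos (.var .u)) (.nonempty .neg (.var .u)))
      (.ifte (.eq (.cell .pebble (.var .u)) (.lit 1))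
        (.head .v .pos (.var .u) ;; .call .injectPebble [(.v, .var .v)])
        (.head .v .neg (.var .u) ;; .call .extractPebble [(.v, .var .v)]))) σ σ' t ∧
      Progress I r σ σ' ∧ σ'.loc .u = ref u ∧ (∀ x, bits (σ'.loc x) ≤ word n) ∧
      σ'.lists .child = σ.lists .child ∧ (∀ v, I.Child r v u → dem n σ' v = 0) ∧
      t + 120 * word n * togo n σ' ≤ 120 * word n * togo n σ + 5 * word n := by
  induction m using Nat.strong_induction_on with
  | _ m ih =>
    rintro σ rfl hσ hu hloc h0
    have h4 := four_le_word hn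
    have hbu := bits_ref_le u
    have hcost : (Cond.or (.nonempty .pos (.var .u)) (.nonempty .neg (.var .u))).cost σ
        ≤ 5 * word n := by
      simp [Cond.cost, Expr.cost, hu]
      omega
    by_cases hne : ∃ v, I.Child r v u ∧ dem n σ v ≠ 0
    · obtain ⟨σ₁, t₁, h1, h2, h3, h5, h6, h7, h8⟩ := exec_balance_step hn hσ hu hloc h0 hne
      obtain ⟨σ₂, t₂, k1, k2, k3, k5, k6, k7, k8⟩ :=
        ih _ h7 rfl h2.1 h3 h5 (h2.zero u h0)
      refine ⟨σ₂, _, .loopTrue ?_ h1 k1, h2.trans k2, k3, k5, k6.trans h6, k7, ?_⟩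
      · obtain ⟨v, hc, hv⟩ := hne
        simp only [Cond.Holds, Expr.eval, hu, Ne, (hσ.pos u).eq_nil_iff, (hσ.neg u).eq_nil_iff]
        rcases lt_or_gt_of_ne hv with h | h
        · exact Or.inr fun hall => hall v ⟨hc, h⟩
        · exact Or.inl fun hall => hall v ⟨hc, h⟩
      -- The rate rises from 100 to 120: the additional 20 words per unit of `togo` pay for the loop
      -- test (5) and the overhead of the step (15).
      · have h9 : 20 * word n * togo n σ₁ + 20 * word n ≤ 20 * word n * togo n σ := by
          rw [← Nat.mul_succ]
          exact Nat.mul_le_mul_left _ h7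
        have e : ∀ m, 120 * word n * m = 100 * word n * m + 20 * word n * m := fun m => by ring
        rw [e, e] at *
        omega
    · push Not at hne
      refine ⟨σ, _, .loopFalse ?_, hσ.refl, hu, hloc, rfl, hne, by omega⟩
      simp only [Cond.Holds, Expr.eval, hu, Ne, (hσ.pos u).eq_nil_iff, (hσ.neg u).eq_nil_iff]
      rintro (h | h)
      · exact h fun v hv => hv.2.ne' (hne v hv.1)
      · exact h fun v hv => hv.2.ne (hne v hv.1)

/-- The specification of `balanceSubtrees` at the node `u`. -/
def Balances (I : Instance n) (r u : Fin n) : Prop :=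
  ∀ σ : State, Consistent I r σ → σ.loc .u = ref u → (∀ x, bits (σ.loc x) ≤ word n) →
    dem n σ u = 0 →
    (∀ x ∈ I.subtree r u, Enumerates (σ.lists .child (ref x)) fun v => I.Child r v x) →
    ∃ σ' t, Exec program balanceSubtreesBody σ σ' t ∧ Progress I r σ σ' ∧
      (∀ x ∈ I.subtree r u, dem n σ' x = 0) ∧
      (∀ x ∉ I.subtree r u, σ'.lists .child (ref x) = σ.lists .child (ref x)) ∧
      t + 15 * word n + 120 * word n * togo n σ' ≤
        120 * word n * togo n σ + 40 * word n * (I.subtree r u).card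

/-- The recursion consumes the lists of children. The call on `v` touches only those inside the
subtree of `v`, which is disjoint from the subtrees of the remaining siblings. The 15 spare words in
`Balances` cover test, `pop` and call of an iteration. -/
theorem exec_recurse_loop (hn : 2 ≤ n) {u : Fin n} (l : List (Fin n)) : ∀ {σ : State},
    l.Nodup → (∀ v ∈ l, I.Child r v u ∧ Balances I r v ∧ dem n σ v = 0 ∧
      ∀ x ∈ I.subtree r v, Enumerates (σ.lists .child (ref x)) fun w => I.Child r w x) →
    Consistent I r σ → σ.loc .u = ref u → (∀ x, bits (σ.loc x) ≤ word n) →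
    σ.lists .child (ref u) = l.map ref →
    ∃ σ' t, Exec program (.loop (.nonempty .child (.var .u))
      (.pop .v .child (.var .u) ;; .call .balanceSubtrees [(.u, .var .v)])) σ σ' t ∧
      Progress I r σ σ' ∧ (∀ v ∈ l, ∀ x ∈ I.subtree r v, dem n σ' x = 0) ∧
      (∀ x ∉ I.subtree r u, σ'.lists .child (ref x) = σ.lists .child (ref x)) ∧
      t + 120 * word n * togo n σ' ≤ 120 * word n * togo n σ + 2 * word n +
        (l.map fun v => 40 * word n * (I.subtree r v).card).sum := by
  induction l with
  | nil =>
    intro σ _ _ hσ hu hloc hl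
    refine ⟨σ, _, .loopFalse ?_, hσ.refl, by simp, fun _ _ => rfl, ?_⟩
    · simp [Cond.Holds, Expr.eval, hu, hl]
    · have := bits_ref_le u
      have := four_le_word hn
      simp [Cond.cost, Expr.cost, hu]
      omega
  | cons v l ih =>
    intro σ hnd hmem hσ hu hloc hl
    obtain ⟨hvl, hnd⟩ := List.nodup_cons.1 hnd
    obtain ⟨hc, hbal, hdv, hen⟩ := hmem v (by simp)
    have h4 := four_le_word hn
    have hbu := bits_ref_le u
    have hbv := bits_ref_le v
    set σ₁ : State := (σ.setList .child (ref u) (l.map ref)).setVar .v (ref v) with hσ₁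
    have pop : Exec program (.pop .v .child (.var .u)) σ σ₁ (bits (ref u) + bits (ref v)) := by
      have := Exec.pop (P := program) .v .child (.var .u) σ (ref v) (l.map ref)
        (by simpa [Expr.eval, hu] using hl)
      simpa [Expr.eval, Expr.cost, hu] using this
    have hloc1 : ∀ x, bits (σ₁.loc x) ≤ word n := bits_update_le hloc hbv
    have hch : ∀ x ≠ u, σ₁.lists .child (ref x) = σ.lists .child (ref x) := by
      intro x hx
      simp [hσ₁, State.setVar, State.setList, hx]
    have hcons : Consistent I r σ₁ := by
      refine ⟨hσ.1, hσ.2, hσ.3, hσ.4, fun x => ?_, fun x => ?_⟩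
      · exact hσ.pos x
      · exact hσ.neg x
    have hprog : Progress I r σ σ₁ := ⟨hcons, hσ.refl.2, hσ.refl.3⟩
    obtain ⟨σ₂, t₂, h1, h2, h3, h5, h6⟩ := hbal _ (hcons.setLoc (newFrame σ₁ [(.u, .var .v)]))
      (by simp [newFrame, Expr.eval, hσ₁, State.setVar]) (bits_newFrame_le hn hloc1) hdv
      (fun x hx => by
        have hxu : x ≠ u := by rintro rfl; exact hc.notMem_subtree hx
        simpa [hch x hxu] using hen x hx)
    have hp2 : Progress I r σ { σ₂ with loc := σ₁.loc } :=
      hprog.trans (h2.setLoc σ₁.loc σ₁.loc)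
    obtain ⟨σ₃, t₃, k1, k2, k3, k5, k6⟩ := ih (σ := { σ₂ with loc := σ₁.loc }) hnd
      (fun w hw => by
        obtain ⟨hcw, hbw, hdw, hew⟩ := hmem w (by simp [hw])
        refine ⟨hcw, hbw, hp2.zero w hdw, fun x hx => ?_⟩
        have hxu : x ≠ u := by rintro rfl; exact hcw.notMem_subtree hx
        have hxv : x ∉ I.subtree r v := fun hxv =>
          hvl (hc.eq_of_mem_subtree hcw hxv hx ▸ hw)
        have : σ₂.lists .child (ref x) = σ.lists .child (ref x) := (h5 x hxv).trans (hch x hxu)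
        simpa [this] using hew x hx)
      hp2.1 (by simp [hσ₁, State.setVar, State.setList, hu]) hloc1
      ((h5 u hc.notMem_subtree).trans (by simp [hσ₁, State.setVar, State.setList]))
    refine ⟨σ₃, _, .loopTrue ?_ (.seq pop (.call h1)) k1, hp2.trans k2, ?_, ?_, ?_⟩
    · simp [Cond.Holds, Expr.eval, hu, hl]
    · intro w hw x hx
      rcases List.mem_cons.1 hw with rfl | hw
      · exact k2.zero x (h3 x hx)
      · exact k3 w hw x hx
    · intro x hx
      have hxu : x ≠ u := by rintro rfl; exact hx (by simp)
      rw [k5 x hx]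
      exact (h5 x fun h => hx (hc.subtree_subset h)).trans (hch x hxu)
    · have := sum_bits_loc_le hloc1
      have := hloc1 .v
      change _ ≤ 120 * word n * togo n σ + _ at h6
      change _ ≤ 120 * word n * togo n σ₂ + _ + _ at k6
      simp only [Cond.cost, Expr.cost, hu, List.map_cons, List.map_nil, List.sum_cons,
        List.sum_nil]
      omega

theorem sum_map_children {l' : List (Fin n)} {u : Fin n} {M : Type*}
    [AddCommMonoid M] (f : Fin n → M) (hnd : l'.Nodup) (h : ∀ v, v ∈ l' ↔ I.Child r v u) :
    (l'.map f).sum = ∑ v ∈ I.children r u, f v := by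
  classical
  rw [← List.sum_toFinset f hnd]
  congr 1
  ext v
  simp [h]

theorem balances (hn : 2 ≤ n) (u : Fin n) : Balances I r u := by
  refine I.leaf_induction r (fun u ih => ?_) u
  intro σ hσ hu hloc h0 hen
  have h4 := four_le_word hn
  obtain ⟨σ₁, t₁, h1, h2, h3, h5, h6, h7, h8⟩ := exec_balance_loop hn _ rfl hσ hu hloc h0
  obtain ⟨l, hl, hnd, hmem⟩ := hen u (by simp)
  obtain ⟨σ₂, t₂, k1, k2, k3, k5, k6⟩ := exec_recurse_loop hn (u := u) l (σ := σ₁) hnd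
    (fun v hv => by
      have hc := (hmem v).1 hv
      refine ⟨hc, ih v hc, h7 v hc, fun x hx => ?_⟩
      rw [h6]
      exact hen x (hc.subtree_subset hx)) h2.1 h3 h5 (by rw [h6, hl])
  refine ⟨σ₂, _, .seq h1 k1, h2.trans k2, fun x hx => ?_, fun x hx => ?_, ?_⟩
  · rcases Instance.mem_subtree.1 hx with rfl | ⟨v, hc, hxv⟩
    · exact k2.zero x (h2.zero x h0)
    · exact k3 v ((hmem v).2 hc) x hxv
  · rw [k5 x hx, h6]
  -- The 40 words charged to `u` itself cover 5 and 2 from the two loops and the 15 reserved for the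
  -- caller.
  · rw [Instance.card_subtree, mul_add, Finset.mul_sum,
      ← sum_map_children (fun v => 40 * word n * (I.subtree r v).card) hnd hmem]
    omega

/-! ## Computing the demands -/

/-- The node `x` has its input data, and nothing has been computed for it. -/
structure Fresh (I : Instance n) (x : Fin n) (σ : State) : Prop where
  pebble : σ.mem .pebble (ref x) = if x ∈ I.start then 1 else 0
  target : σ.mem .target (ref x) = if x ∈ I.targets then 1 else 0
  nbrs : σ.lists .nbrs (ref x) = (I.nbrs x).map ref
  child : σ.lists .child (ref x) = []
  pos : σ.lists .pos (ref x) = []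
  neg : σ.lists .neg (ref x) = []

/-- The data of the node `x` are correct up to the contributions of the nodes in `l`, which have
not been considered yet. -/
structure Partial (I : Instance n) (r x : Fin n) (l : List (Fin n)) (σ : State) : Prop where
  parent : σ.mem .parent (ref x) = parentRef I r x
  demand : σ.mem .demand (ref x) = (if x ∈ I.targets then 1 else 0) - (if x ∈ I.start then 1 else 0)
    + ∑ v ∈ (I.children r x).filter (· ∉ l), I.demand r v
  child : Enumerates (σ.lists .child (ref x)) fun v => I.Child r v x ∧ v ∉ l
  pos : Enumerates (σ.lists .pos (ref x)) fun v => (I.Child r v x ∧ v ∉ l) ∧ 0 < I.demand r v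
  neg : Enumerates (σ.lists .neg (ref x)) fun v => (I.Child r v x ∧ v ∉ l) ∧ I.demand r v < 0

/-- The data of the node `x` are the same in both states. -/
structure SameAt (x : Fin n) (σ σ' : State) : Prop where
  parent : σ'.mem .parent (ref x) = σ.mem .parent (ref x)
  demand : σ'.mem .demand (ref x) = σ.mem .demand (ref x)
  nbrs : σ'.lists .nbrs (ref x) = σ.lists .nbrs (ref x)
  child : σ'.lists .child (ref x) = σ.lists .child (ref x)
  pos : σ'.lists .pos (ref x) = σ.lists .pos (ref x)
  neg : σ'.lists .neg (ref x) = σ.lists .neg (ref x)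

/-- Pebbles, targets and the output are the same in both states. -/
structure SameIO (σ σ' : State) : Prop where
  pebble : σ'.mem .pebble = σ.mem .pebble
  target : σ'.mem .target = σ.mem .target
  out : σ'.out = σ.out

theorem SameAt.trans {x : Fin n} {σ σ' σ'' : State} (h : SameAt x σ σ') (h' : SameAt x σ' σ'') :
    SameAt x σ σ'' :=
  ⟨h'.1.trans h.1, h'.2.trans h.2, h'.3.trans h.3, h'.4.trans h.4, h'.5.trans h.5, h'.6.trans h.6⟩

theorem SameIO.trans {σ σ' σ'' : State} (h : SameIO σ σ') (h' : SameIO σ' σ'') : SameIO σ σ'' :=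
  ⟨h'.1.trans h.1, h'.2.trans h.2, h'.3.trans h.3⟩

theorem SameAt.setLoc {x : Fin n} {σ σ' : State} (h : SameAt x σ σ') (ρ ρ' : Var → ℤ) :
    SameAt x { σ with loc := ρ } { σ' with loc := ρ' } := ⟨h.1, h.2, h.3, h.4, h.5, h.6⟩

theorem SameIO.setLoc {σ σ' : State} (h : SameIO σ σ') (ρ ρ' : Var → ℤ) :
    SameIO { σ with loc := ρ } { σ' with loc := ρ' } := ⟨h.1, h.2, h.3⟩

theorem Fresh.of_same {x : Fin n} {σ σ' : State} (h : Fresh I x σ) (hx : SameAt x σ σ')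
    (hio : SameIO σ σ') : Fresh I x σ' :=
  ⟨hio.1 ▸ h.1, hio.2 ▸ h.2, hx.3 ▸ h.3, hx.4 ▸ h.4, hx.5 ▸ h.5, hx.6 ▸ h.6⟩

theorem Partial.of_same {x : Fin n} {l : List (Fin n)} {σ σ' : State} (h : Partial I r x l σ)
    (hx : SameAt x σ σ') : Partial I r x l σ' :=
  ⟨hx.1 ▸ h.1, hx.2 ▸ h.2, hx.4 ▸ h.3, hx.5 ▸ h.4, hx.6 ▸ h.5⟩

theorem Partial.demand_eq {x : Fin n} {σ : State} (h : Partial I r x [] σ) :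
    σ.mem .demand (ref x) = I.demand r x := by
  rw [h.demand, Instance.isDemand_demand x]
  simp

/-- For the parent of `u`, which occurs in the neighbour list but contributes nothing. -/
theorem Partial.skip {u v : Fin n} {l : List (Fin n)} {σ : State} (h : Partial I r u (v :: l) σ)
    (hc : ¬ I.Child r v u) : Partial I r u l σ := by
  have key : ∀ w, I.Child r w u ∧ w ∉ v :: l ↔ I.Child r w u ∧ w ∉ l := by
    intro w
    refine and_congr_right fun hw => ?_
    have : w ≠ v := by rintro rfl; exact hc hw
    simp [this]
  refine ⟨h.1, ?_, h.3.congr key, h.4.congr fun w => by rw [key], h.5.congr fun w => by rw [key]⟩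
  rw [h.2]
  congr 2
  ext w
  simpa using key w

/-- Intermediate values of a demand are bounded crudely: at most `n` summands, each at most `n` in
absolute value, plus the contribution of `x`. This is the reason for `2 * n ^ 2` in `word`. -/
theorem bits_partial_le (hn : 2 ≤ n) (x : Fin n) (s : Finset (Fin n)) :
    bits ((if x ∈ I.targets then 1 else 0) - (if x ∈ I.start then 1 else 0)
      + ∑ v ∈ s, I.demand r v) ≤ word n := by
  refine bits_le_word ?_
  have h1 : |∑ v ∈ s, I.demand r v| ≤ ∑ _v ∈ s, (n : ℤ) := by
    refine (Finset.abs_sum_le_sum_abs _ _).trans (Finset.sum_le_sum fun v _ => ?_)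
    have := Instance.natAbs_demand_le (I := I) (r := r) v
    rw [Int.abs_eq_natAbs]
    exact_mod_cast this
  have h2 : s.card * n ≤ n ^ 2 := by
    rw [pow_two]
    exact Nat.mul_le_mul_right _ (by simpa using Finset.card_le_univ s)
  have h3 : 4 ≤ n ^ 2 := by nlinarith
  rw [Finset.sum_const, Int.abs_eq_natAbs, nsmul_eq_mul] at h1
  have h1' : (∑ v ∈ s, I.demand r v).natAbs ≤ s.card * n := by exact_mod_cast h1
  split_ifs <;> omega

theorem bits_newFrame_two_le {σ : State} {x x' : Var} {e e' : Expr} (hn : 2 ≤ n)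
    (he : bits (e.eval σ) ≤ word n) (he' : bits (e'.eval σ) ≤ word n) (z : Var) :
    bits (newFrame σ [(x, e), (x', e')] z) ≤ word n := by
  simp only [newFrame, List.foldl_cons, List.foldl_nil, Function.update_apply]
  split_ifs
  · exact he'
  · exact he
  · rw [bits_zero]
    have := four_le_word hn
    omega

/-- The specification of `computeDemand` at the node `u`. -/
def Computes (I : Instance n) (r u : Fin n) : Prop :=
  ∀ σ : State, σ.loc .u = ref u → σ.loc .p = parentRef I r u → (∀ x, bits (σ.loc x) ≤ word n) →
    (∀ x ∈ I.subtree r u, Fresh I x σ) →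
    ∃ σ' t, Exec program computeDemandBody σ σ' t ∧ (∀ x ∈ I.subtree r u, Partial I r x [] σ') ∧
      (∀ x ∉ I.subtree r u, SameAt x σ σ') ∧ SameIO σ σ' ∧
      t + 40 * word n ≤ 60 * word n * (I.subtree r u).card

/-- The child `v` of `u` is taken into account at `u`. -/
theorem exec_absorb (hn : 2 ≤ n) {u v : Fin n} {l : List (Fin n)} {σ : State}
    (hu : σ.loc .u = ref u) (hv : σ.loc .v = ref v) (hc : I.Child r v u) (hvl : v ∉ l)
    (hpu : Partial I r u (v :: l) σ) (hpv : Partial I r v [] σ) :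
    ∃ σ' t, Exec program
      (.write .demand (.var .u) (.add (.cell .demand (.var .u)) (.cell .demand (.var .v))) ;;
        .push .child (.var .u) (.var .v) ;;
        .ifte (.lt (.lit 0) (.cell .demand (.var .v)))
          (.push .pos (.var .u) (.var .v))
          (.ifte (.lt (.cell .demand (.var .v)) (.lit 0))
            (.push .neg (.var .u) (.var .v))
            (.push .zero (.var .u) (.var .v)))) σ σ' t ∧
      σ'.loc = σ.loc ∧ Partial I r u l σ' ∧ (∀ x ≠ u, SameAt x σ σ') ∧ SameIO σ σ' ∧
      σ'.lists .nbrs = σ.lists .nbrs ∧ t ≤ 22 * word n := by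
  have h4 := four_le_word hn
  have hbu := bits_ref_le u
  have hbv := bits_ref_le v
  have hne := hc.ne
  have hdv := hpv.demand_eq
  have hfil : (I.children r u).filter (· ∉ l) =
      insert v ((I.children r u).filter (· ∉ v :: l)) := by
    ext w
    by_cases hw : w = v
    · subst hw; simp [hc, hvl]
    · simp [hw]
  have hsum : σ.mem .demand (ref u) + σ.mem .demand (ref v) =
      (if u ∈ I.targets then 1 else 0) - (if u ∈ I.start then 1 else 0)
        + ∑ v ∈ (I.children r u).filter (· ∉ l), I.demand r v := by
    rw [hpu.demand, hdv, hfil, Finset.sum_insert (by simp)]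
    ring
  have hb1 : bits (σ.mem .demand (ref u)) ≤ word n := by
    rw [hpu.demand]; exact bits_partial_le hn u _
  have hb2 : bits (σ.mem .demand (ref u) + σ.mem .demand (ref v)) ≤ word n := by
    rw [hsum]; exact bits_partial_le hn u _
  have hb3 : bits (σ.mem .demand (ref v)) ≤ word n := by
    rw [hdv]
    have := Instance.natAbs_demand_le (I := I) (r := r) v
    exact bits_le_word_of_le hn (by omega)
  have hchild : ∀ w, I.Child r w u ∧ w ∉ l ↔ w = v ∨ I.Child r w u ∧ w ∉ v :: l := by
    intro w
    by_cases hw : w = v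
    · subst hw; simp [hc, hvl]
    · simp [hw]
  -- In each of the three sign cases, this serves a list that `v` does not enter, and `hadd` the one
  -- that it does.
  have hsame : ∀ {P : Fin n → Prop} {L : List ℤ}, ¬ P v →
      Enumerates L (fun w => (I.Child r w u ∧ w ∉ v :: l) ∧ P w) →
      Enumerates L (fun w => (I.Child r w u ∧ w ∉ l) ∧ P w) := by
    intro P L hP h
    refine h.congr fun w => ?_
    by_cases hw : w = v
    · subst hw; simp [hP]
    · simp [hw]
  have hadd : ∀ {P : Fin n → Prop} {L : List ℤ}, P v →
      Enumerates L (fun w => (I.Child r w u ∧ w ∉ v :: l) ∧ P w) →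
      Enumerates (ref v :: L) (fun w => (I.Child r w u ∧ w ∉ l) ∧ P w) := by
    intro P L hP h
    refine h.cons (by simp) fun w => ?_
    by_cases hw : w = v
    · subst hw; simp [hP, hc, hvl]
    · simp [hw]
  by_cases hpos : 0 < σ.mem .demand (ref v)
  · refine ⟨_, _, .seq (.write ..) (.seq (.push ..) (.ifTrue ?_ (.push ..))), rfl, ?_, ?_, ?_, ?_, ?_⟩
    · simpa [Cond.Holds, Expr.eval, State.setCell, State.setList, hu, hv, hne] using hpos
    · rw [hdv] at hpos
      constructor <;> simp [Expr.eval, State.setCell, State.setList, hu, hv]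
      · exact hpu.parent
      · rw [hsum]
      · exact hpu.child.cons (by simp) hchild
      · exact hadd hpos hpu.pos
      · exact hsame hpos.not_gt hpu.neg
    · intro x hx
      constructor <;> simp [Expr.eval, State.setCell, State.setList, hu, hx]
    · constructor <;> simp [State.setCell, State.setList]
    · simp [State.setCell, State.setList]
    · simp [Cond.cost, Expr.cost, Expr.eval, State.setCell, State.setList, hu, hv, hne, bits_zero]
      omega
  by_cases hneg : σ.mem .demand (ref v) < 0
  · refine ⟨_, _, .seq (.write ..) (.seq (.push ..) (.ifFalse ?_ (.ifTrue ?_ (.push ..)))), rfl,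
      ?_, ?_, ?_, ?_, ?_⟩
    · simpa [Cond.Holds, Expr.eval, State.setCell, State.setList, hu, hv, hne] using hpos
    · simpa [Cond.Holds, Expr.eval, State.setCell, State.setList, hu, hv, hne] using hneg
    · rw [hdv] at hpos hneg
      constructor <;> simp [Expr.eval, State.setCell, State.setList, hu, hv]
      · exact hpu.parent
      · rw [hsum]
      · exact hpu.child.cons (by simp) hchild
      · exact hsame hpos hpu.pos
      · exact hadd (P := fun w => I.demand r w < 0) hneg hpu.neg
    · intro x hx
      constructor <;> simp [Expr.eval, State.setCell, State.setList, hu, hx]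
    · constructor <;> simp [State.setCell, State.setList]
    · simp [State.setCell, State.setList]
    · simp [Cond.cost, Expr.cost, Expr.eval, State.setCell, State.setList, hu, hv, hne, bits_zero]
      omega
  · refine ⟨_, _, .seq (.write ..) (.seq (.push ..) (.ifFalse ?_ (.ifFalse ?_ (.push ..)))), rfl,
      ?_, ?_, ?_, ?_, ?_⟩
    · simpa [Cond.Holds, Expr.eval, State.setCell, State.setList, hu, hv, hne] using hpos
    · simpa [Cond.Holds, Expr.eval, State.setCell, State.setList, hu, hv, hne] using hneg
    · rw [hdv] at hpos hneg
      constructor <;> simp [Expr.eval, State.setCell, State.setList, hu, hv]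
      · exact hpu.parent
      · rw [hsum]
      · exact hpu.child.cons (by simp) hchild
      · exact hsame hpos hpu.pos
      · exact hsame (P := fun w => I.demand r w < 0) hneg hpu.neg
    · intro x hx
      constructor <;> simp [Expr.eval, State.setCell, State.setList, hu, hx]
    · constructor <;> simp [State.setCell, State.setList]
    · simp [State.setCell, State.setList]
    · simp [Cond.cost, Expr.cost, Expr.eval, State.setCell, State.setList, hu, hv, hne, bits_zero]
      omega

-- A neighbour of `u` is its parent, which is skipped within 8 words, or a child. The call on a
-- child `v` changes only data in the subtree of `v`, so the later children are still fresh. Test,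
-- `pop`, comparison, call and absorption fit into the 40 spare words of `Computes`, hence a child
-- costs no more than 60 words per node of its subtree.
open Classical in
theorem exec_nbrs_loop (hn : 2 ≤ n) {u : Fin n} (l : List (Fin n)) : ∀ {σ : State},
    l.Nodup → (∀ v ∈ l, I.graph.Adj u v ∧ (I.Child r v u → Computes I r v ∧
      ∀ x ∈ I.subtree r v, Fresh I x σ)) →
    σ.loc .u = ref u → σ.loc .p = parentRef I r u → (∀ x, bits (σ.loc x) ≤ word n) →
    σ.lists .nbrs (ref u) = l.map ref → Partial I r u l σ →
    ∃ σ' t, Exec program (.loop (.nonempty .nbrs (.var .u))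
      (.pop .v .nbrs (.var .u) ;;
        .ifte (.eq (.var .v) (.var .p))
          .skip
          (.call .computeDemand [(.u, .var .v), (.p, .var .u)] ;;
            .write .demand (.var .u) (.add (.cell .demand (.var .u)) (.cell .demand (.var .v))) ;;
            .push .child (.var .u) (.var .v) ;;
            .ifte (.lt (.lit 0) (.cell .demand (.var .v)))
              (.push .pos (.var .u) (.var .v))
              (.ifte (.lt (.cell .demand (.var .v)) (.lit 0))
                (.push .neg (.var .u) (.var .v))
                (.push .zero (.var .u) (.var .v)))))) σ σ' t ∧
      Partial I r u [] σ' ∧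
      (∀ v ∈ l, I.Child r v u → ∀ x ∈ I.subtree r v, Partial I r x [] σ') ∧
      (∀ x, x ≠ u → (∀ v ∈ l, I.Child r v u → x ∉ I.subtree r v) → SameAt x σ σ') ∧
      SameIO σ σ' ∧
      t ≤ 2 * word n +
        (l.map fun v => if I.Child r v u then 60 * word n * (I.subtree r v).card
          else 8 * word n).sum := by
  have h4 := four_le_word hn
  have hbu := bits_ref_le u
  induction l with
  | nil =>
    intro σ _ _ hu hp hloc hl hpart
    refine ⟨σ, _, .loopFalse ?_, hpart, by simp, fun x _ _ => ⟨rfl, rfl, rfl, rfl, rfl, rfl⟩,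
      ⟨rfl, rfl, rfl⟩, ?_⟩
    · simp [Cond.Holds, Expr.eval, hu, hl]
    · simp [Cond.cost, Expr.cost, hu]
      omega
  | cons v l ih =>
    intro σ hnd hmem hu hp hloc hl hpart
    obtain ⟨hvl, hnd⟩ := List.nodup_cons.1 hnd
    obtain ⟨hadj, hcomp⟩ := hmem v (by simp)
    have hbv := bits_ref_le v
    have hbp := bits_parentRef_le hn I r u
    set σ₁ : State := (σ.setList .nbrs (ref u) (l.map ref)).setVar .v (ref v) with hσ₁
    have pop : Exec program (.pop .v .nbrs (.var .u)) σ σ₁ (bits (ref u) + bits (ref v)) := by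
      have := Exec.pop (P := program) .v .nbrs (.var .u) σ (ref v) (l.map ref)
        (by simpa [Expr.eval, hu] using hl)
      simpa [Expr.eval, Expr.cost, hu] using this
    have hloc1 : ∀ x, bits (σ₁.loc x) ≤ word n := bits_update_le hloc hbv
    have hu1 : σ₁.loc .u = ref u := by simp [hσ₁, State.setVar, State.setList, hu]
    have hv1 : σ₁.loc .v = ref v := by simp [hσ₁, State.setVar]
    have hp1 : σ₁.loc .p = parentRef I r u := by simp [hσ₁, State.setVar, State.setList, hp]
    have hl1 : σ₁.lists .nbrs (ref u) = l.map ref := by simp [hσ₁, State.setVar, State.setList]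
    have hsame1 : ∀ x ≠ u, SameAt x σ σ₁ := fun x hx =>
      ⟨rfl, rfl, by simp [hσ₁, State.setVar, State.setList, hx], rfl, rfl, rfl⟩
    have hio1 : SameIO σ σ₁ := ⟨rfl, rfl, rfl⟩
    have hpart1 : Partial I r u (v :: l) σ₁ := ⟨hpart.1, hpart.2, hpart.3, hpart.4, hpart.5⟩
    have hcond : (Cond.nonempty .nbrs (.var .u)).Holds σ := by
      simp [Cond.Holds, Expr.eval, hu, hl]
    by_cases hc : I.Child r v u
    · obtain ⟨hcomp, hfresh⟩ := hcomp hc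
      have hvp : ref v ≠ parentRef I r u := by
        intro h
        have := (child_of_parentRef h.symm).dist
        have := hc.dist
        omega
      have hnu : ∀ {w x}, I.Child r w u → x ∈ I.subtree r w → x ≠ u := by
        rintro w x hw hx rfl
        exact hw.notMem_subtree hx
      set ρ := newFrame σ₁ [(.u, .var .v), (.p, .var .u)] with hρ
      obtain ⟨σ₂, t₂, h1, h2, h3, h5, h6⟩ := hcomp { σ₁ with loc := ρ }
        (by simp [hρ, newFrame, Expr.eval, hv1])
        (by simp [hρ, newFrame, Expr.eval, hu1, hc.parentRef])
        (bits_newFrame_two_le hn (hloc1 .v) (hloc1 .u))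
        (fun x hx => (hfresh x hx).of_same ((hsame1 x (hnu hc hx)).setLoc σ.loc ρ)
          (hio1.setLoc σ.loc ρ))
      have h3' : ∀ x ∉ I.subtree r v, SameAt x σ₁ { σ₂ with loc := σ₁.loc } :=
        fun x hx => (h3 x hx).setLoc σ₁.loc σ₁.loc
      have h5' : SameIO σ₁ { σ₂ with loc := σ₁.loc } := h5.setLoc σ₁.loc σ₁.loc
      have h2' : ∀ x ∈ I.subtree r v, Partial I r x [] { σ₂ with loc := σ₁.loc } :=
        fun x hx => ⟨(h2 x hx).1, (h2 x hx).2, (h2 x hx).3, (h2 x hx).4, (h2 x hx).5⟩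
      obtain ⟨σ₃, t₃, k1, k2, k3, k5, k6, k7, k8⟩ :=
        exec_absorb (σ := { σ₂ with loc := σ₁.loc }) hn hu1 hv1 hc hvl
          (hpart1.of_same (h3' u hc.notMem_subtree)) (h2' v (by simp))
      have hsame3 : ∀ x ≠ u, x ∉ I.subtree r v → SameAt x σ σ₃ := fun x hx hxv =>
        (hsame1 x hx).trans ((h3' x hxv).trans (k5 x hx))
      have hio3 : SameIO σ σ₃ := hio1.trans (h5'.trans k6)
      obtain ⟨σ₄, t₄, j1, j2, j3, j5, j6, j7⟩ := ih (σ := σ₃) hnd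
        (fun w hw => by
          obtain ⟨hadjw, hw'⟩ := hmem w (by simp [hw])
          refine ⟨hadjw, fun hcw => ?_⟩
          obtain ⟨hcw1, hcw2⟩ := hw' hcw
          refine ⟨hcw1, fun x hx => (hcw2 x hx).of_same (hsame3 x (hnu hcw hx) fun hxv => ?_) hio3⟩
          exact hvl (hc.eq_of_mem_subtree hcw hxv hx ▸ hw))
        (by rw [k2]; exact hu1) (by rw [k2]; exact hp1) (by rw [k2]; exact hloc1)
        (by rw [k7]; exact (h3' u hc.notMem_subtree).nbrs.trans hl1) k3
      refine ⟨σ₄, _, .loopTrue hcond (.seq pop (.ifFalse ?_ (.seq (.call h1) k1))) j1, j2,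
        ?_, ?_, hio3.trans j6, ?_⟩
      · simpa [Cond.Holds, Expr.eval, hv1, hp1] using hvp
      · intro w hw hcw x hx
        rcases List.mem_cons.1 hw with rfl | hw
        · refine ((h2' x hx).of_same (k5 x (hnu hcw hx))).of_same (j5 x (hnu hcw hx) ?_)
          intro w' hw' hcw' hx'
          exact hvl (hc.eq_of_mem_subtree hcw' hx hx' ▸ hw')
        · exact j3 w hw hcw x hx
      · intro x hx hxl
        exact (hsame3 x hx (hxl v (by simp) hc)).trans
          (j5 x hx fun w hw => hxl w (by simp [hw]))
      · have := sum_bits_loc_le hloc1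
        simp only [Cond.cost, Expr.cost, hu, hv1, hu1, hp1, List.map_cons, List.map_nil,
          List.sum_cons, List.sum_nil, if_pos hc]
        omega
    · have hcu : I.Child r u v := (Instance.child_or_child_of_adj r hadj).resolve_left hc
      obtain ⟨σ₄, t₄, j1, j2, j3, j5, j6, j7⟩ := ih (σ := σ₁) hnd
        (fun w hw => by
          obtain ⟨hadjw, hw'⟩ := hmem w (by simp [hw])
          refine ⟨hadjw, fun hcw => ⟨(hw' hcw).1, fun x hx => ?_⟩⟩
          refine ((hw' hcw).2 x hx).of_same (hsame1 x ?_) hio1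
          rintro rfl
          exact hcw.notMem_subtree hx)
        hu1 hp1 hloc1 hl1 (hpart1.skip hc)
      refine ⟨σ₄, _, .loopTrue hcond (.seq pop (.ifTrue ?_ (.skip _))) j1, j2, ?_, ?_,
        hio1.trans j6, ?_⟩
      · simp [Cond.Holds, Expr.eval, hv1, hp1, hcu.parentRef]
      · intro w hw hcw x hx
        rcases List.mem_cons.1 hw with rfl | hw
        · exact absurd hcw hc
        · exact j3 w hw hcw x hx
      · intro x hx hxl
        exact (hsame1 x hx).trans (j5 x hx fun w hw => hxl w (by simp [hw]))
      · simp only [Cond.cost, Expr.cost, hu, hv1, hp1, List.map_cons, List.sum_cons, if_neg hc]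
        omega

-- At most one neighbour of `u` is not a child, namely the parent.
open Classical in
theorem sum_nbrs_le (u : Fin n) (f : Fin n → ℕ) (c : ℕ) :
    ((I.nbrs u).map fun v => if I.Child r v u then f v else c).sum ≤
      c + ∑ v ∈ I.children r u, f v := by
  rw [← List.sum_toFinset _ (I.nodup_nbrs u), Finset.sum_ite, add_comm]
  refine add_le_add ?_ (le_of_eq (Finset.sum_congr ?_ fun _ _ => rfl))
  · rw [Finset.sum_const, smul_eq_mul]
    refine (Nat.mul_le_mul_right c ?_).trans (one_mul c).le
    rw [Finset.card_le_one]
    intro a ha b hb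
    simp only [Finset.mem_filter, List.mem_toFinset, I.mem_nbrs] at ha hb
    exact ((Instance.child_or_child_of_adj r ha.1).resolve_left ha.2).parent_unique
      ((Instance.child_or_child_of_adj r hb.1).resolve_left hb.2)
  · ext v
    simp only [Finset.mem_filter, List.mem_toFinset, I.mem_nbrs, Instance.mem_children]
    exact ⟨fun h => h.2, fun h => ⟨h.adj, h⟩⟩

theorem computes (hn : 2 ≤ n) (u : Fin n) : Computes I r u := by
  refine I.leaf_induction r (fun u ih => ?_) u
  intro σ hu hp hloc hfresh
  have h4 := four_le_word hn
  have hbu := bits_ref_le u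
  have hbp := bits_parentRef_le hn I r u
  have hfu := hfresh u (by simp)
  have hnu : ∀ {w x}, I.Child r w u → x ∈ I.subtree r w → x ≠ u := by
    rintro w x hw hx rfl
    exact hw.notMem_subtree hx
  set δ : ℤ := (if u ∈ I.targets then 1 else 0) - (if u ∈ I.start then 1 else 0) with hδ
  have hbt : bits (σ.mem .target (ref u)) ≤ word n :=
    bits_pebble_le hn (by rw [hfu.target]; split_ifs <;> simp)
  have hbq : bits (σ.mem .pebble (ref u)) ≤ word n :=
    bits_pebble_le hn (by rw [hfu.pebble]; split_ifs <;> simp)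
  have hbδ : bits δ ≤ word n := bits_le_word_of_le hn (by rw [hδ]; split_ifs <;> simp)
  set σ₁ : State := (σ.setCell .parent (ref u) (parentRef I r u)).setCell .demand (ref u) δ with hσ₁
  have h1 := Exec.write (P := program) .parent (.var .u) (.var .p) σ
  simp only [Expr.eval, Expr.cost, hu, hp] at h1
  have h2 := Exec.write (P := program) .demand (.var .u)
    (.sub (.cell .target (.var .u)) (.cell .pebble (.var .u)))
    (σ.setCell .parent (ref u) (parentRef I r u))
  have e1 : (σ.setCell .parent (ref u) (parentRef I r u)).loc .u = ref u := hu
  have e2 : (σ.setCell .parent (ref u) (parentRef I r u)).mem .target = σ.mem .target := rfl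
  have e3 : (σ.setCell .parent (ref u) (parentRef I r u)).mem .pebble = σ.mem .pebble := rfl
  have e4 : σ.mem .target (ref u) - σ.mem .pebble (ref u) = δ := by
    rw [hfu.target, hfu.pebble]
  simp only [Expr.eval, Expr.cost, e1, e2, e3, e4] at h2
  have hsame1 : ∀ x ≠ u, SameAt x σ σ₁ := fun x hx =>
    ⟨by simp [hσ₁, State.setCell, hx], by simp [hσ₁, State.setCell, hx], rfl, rfl, rfl, rfl⟩
  have hio1 : SameIO σ σ₁ := ⟨rfl, rfl, rfl⟩
  -- Before the loop no child has been considered, so the partial sum and all lists are empty.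
  have hnone : ∀ v, ¬ (I.Child r v u ∧ v ∉ I.nbrs u) := fun v hv =>
    hv.2 ((I.mem_nbrs u v).2 hv.1.adj)
  obtain ⟨σ₂, t₂, k1, k2, k3, k5, k6, k7⟩ := exec_nbrs_loop hn (u := u) (I.nbrs u) (σ := σ₁)
    (r := r) (I.nodup_nbrs u)
    (fun v hv => ⟨(I.mem_nbrs u v).1 hv, fun hc => ⟨ih v hc, fun x hx =>
      (hfresh x (hc.subtree_subset hx)).of_same (hsame1 x (hnu hc hx)) hio1⟩⟩)
    hu hp hloc hfu.nbrs (by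
      refine ⟨by simp [hσ₁, State.setCell], ?_, ?_, ?_, ?_⟩
      · rw [Finset.sum_eq_zero fun v hv => by
          simp only [Finset.mem_filter, Instance.mem_children] at hv
          exact absurd hv (hnone v)]
        simp [hσ₁, State.setCell, hδ]
      · exact (show σ₁.lists .child (ref u) = [] from hfu.child) ▸ .nil hnone
      · exact (show σ₁.lists .pos (ref u) = [] from hfu.pos) ▸ .nil fun v hv => hnone v hv.1
      · exact (show σ₁.lists .neg (ref u) = [] from hfu.neg) ▸ .nil fun v hv => hnone v hv.1)
  refine ⟨σ₂, _, .seq h1 (.seq h2 k1), fun x hx => ?_, fun x hx => ?_, hio1.trans k6, ?_⟩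
  · rcases Instance.mem_subtree.1 hx with rfl | ⟨v, hc, hxv⟩
    · exact k2
    · exact k3 v ((I.mem_nbrs u v).2 hc.adj) hc x hxv
  · have hxu : x ≠ u := by rintro rfl; exact hx (by simp)
    exact (hsame1 x hxu).trans (k5 x hxu fun v _ hc hxv => hx (hc.subtree_subset hxv))
  -- The 60 words charged to `u` are used up exactly: 3 and 7 for the two writes, 2 for the last
  -- loop test, 8 for the parent, and 40 reserved for the caller.
  · have h5 := sum_nbrs_le (I := I) (r := r) u
      (fun v => 60 * word n * (I.subtree r v).card) (8 * word n)
    rw [Instance.card_subtree, mul_add, Finset.mul_sum]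
    omega

/-! ## The whole algorithm -/

theorem tabulate_ref {α : Type} (d : α) (f : Fin n → α) (x : Fin n) :
    tabulate d f (ref x) = f x := by
  have h : 0 ≤ ref x ∧ (ref x).toNat < n := by simp [ref]
  rw [tabulate, dif_pos h]
  rfl

theorem fresh_load (I : Instance n) (x : Fin n) : Fresh I x (load I) where
  pebble := by simp [load, tabulate_ref]
  target := by simp [load, tabulate_ref]
  nbrs := by
    simp only [load, tabulate_ref, List.pure_def, List.bind_eq_flatMap,
      ← List.map_eq_flatMap, List.map_map]
    rfl
  child := rfl
  pos := rfl
  neg := rfl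

theorem consistent_of_partial {σ : State} (hio : SameIO (load I) σ)
    (h : ∀ x, Partial I r x [] σ) :
    Consistent I r σ ∧ pebbled n σ = I.start ∧ dem n σ = I.demand r := by
  have hp : ∀ x, σ.mem .pebble (ref x) = if x ∈ I.start then 1 else 0 := fun x => by
    rw [hio.pebble]; exact (fresh_load I x).pebble
  have hS : pebbled n σ = I.start := by
    ext x
    rw [mem_pebbled, hp]
    split_ifs with hx <;> simp [hx]
  have hd : dem n σ = I.demand r := funext fun x => (h x).demand_eq
  refine ⟨⟨fun x => ?_, fun x => (h x).parent, ?_, fun x => ?_, fun u => ?_, fun u => ?_⟩, hS, hd⟩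
  · rw [hp]; split_ifs <;> simp
  · rw [hS, hd]; exact Instance.isDemand_demand
  · rw [hd]; exact Instance.natAbs_demand_le x
  · rw [hd]; exact (h u).pos.congr fun v => by simp
  · rw [hd]; exact (h u).neg.congr fun v => by simp

/-- The algorithm puts out a shortest plan. -/
theorem exists_runs (hn : 2 ≤ n) (I : Instance n) (r : Fin n) :
    ∃ plan t, Runs I r plan t ∧ I.Feasible plan ∧ plan.length = I.opt ∧
      t ≤ 100 * word n * n + 120 * word n * I.opt := by
  have h4 := four_le_word hn
  have hbr : bits ((r : ℕ) : ℤ) ≤ word n := bits_ref_le r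
  have hbits : ∀ z : ℤ, z = 0 ∨ z = -1 → bits z ≤ word n := by
    rintro z (rfl | rfl)
    · rw [bits_zero]; omega
    · rw [bits_neg_one]; omega
  have hloc : ∑ x, bits ((load I).loc x) ≤ 4 * word n :=
    sum_bits_loc_le fun _ => hbits 0 (Or.inl rfl)
  set ρ₁ := newFrame (load I) [(.u, .lit ((r : ℕ) : ℤ)), (.p, .lit (-1))] with hρ₁
  obtain ⟨σ₁, t₁, h1, h2, -, h3, h5⟩ := computes (I := I) (r := r) hn r
    { load I with loc := ρ₁ } (by simp [hρ₁, newFrame, Expr.eval, ref])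
    (by simp [hρ₁, newFrame, Expr.eval, parentRef_root])
    (bits_newFrame_two_le hn hbr (hbits _ (Or.inr rfl)))
    fun x _ => ⟨(fresh_load I x).1, (fresh_load I x).2, (fresh_load I x).3, (fresh_load I x).4,
      (fresh_load I x).5, (fresh_load I x).6⟩
  obtain ⟨hcons, hS, hd⟩ := consistent_of_partial (r := r) (h3.setLoc (load I).loc σ₁.loc)
    fun x => h2 x (Instance.subtree_root x)
  set ρ₂ := newFrame { σ₁ with loc := (load I).loc } [(.u, .lit ((r : ℕ) : ℤ))] with hρ₂
  have hloc2 : ∀ x, bits (ρ₂ x) ≤ word n := by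
    intro x
    simp only [hρ₂, newFrame, List.foldl_cons, List.foldl_nil, Function.update_apply, Expr.eval]
    split_ifs
    · exact hbr
    · exact hbits 0 (Or.inl rfl)
  obtain ⟨σ₂, t₂, k1, k2, k3, -, k5⟩ := balances (I := I) (r := r) hn r { σ₁ with loc := ρ₂ }
    (hcons.setLoc ρ₂) (by simp [hρ₂, newFrame, Expr.eval, ref]) hloc2
    ((congrFun hd r).trans Instance.demand_root)
    fun x _ => (h2 x (Instance.subtree_root x)).child.congr fun v => by simp
  obtain ⟨plan, p1, p2, p3⟩ := k2.plan
  have hzero : dem n σ₂ = 0 := funext fun x => k3 x (Instance.subtree_root x)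
  have htogo2 : togo n σ₂ = 0 := by simp [togo, hzero]
  have htogo1 : togo n { σ₁ with loc := ρ₂ } = ∑ u, (I.demand r u).natAbs :=
    Finset.sum_congr rfl fun u _ => congrArg Int.natAbs (congrFun hd u)
  have hfeas : I.Feasible plan := by
    refine ⟨pebbled n σ₂, ?_, ?_⟩
    · rw [← hS]; exact p1
    · have := k2.consistent.isDemand
      rw [hzero] at this
      rw [this.eq_targets]
  -- `togo` starts at the sum of the absolute demands and ends at zero, so the plan meets the lower
  -- bound.
  have hopt : plan.length = I.opt := Instance.length_eq_opt (r := r) hfeas (by omega)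
  refine ⟨plan, _, ⟨_, .seq (.call h1) (.call k1), ?_⟩, hfeas, hopt, ?_⟩
  · change σ₂.out = _
    rw [p2]
    change σ₁.out ++ _ = _
    rw [h3.out]
    rfl
  · have hcard : I.subtree r r = Finset.univ := Finset.eq_univ_of_forall Instance.subtree_root
    rw [hcard, Finset.card_univ, Fintype.card_fin] at h5 k5
    rw [htogo2, show togo n { σ₁ with loc := ρ₂ } = I.opt by omega] at k5
    have hb1 := hbits _ (Or.inr rfl)
    have e : 100 * word n * n = 60 * word n * n + 40 * word n * n := by ring
    simp only [Expr.cost, List.map_cons, List.map_nil, List.sum_cons, List.sum_nil]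
    rw [e]
    omega

/-! ## Sizes of the encodings -/

theorem length_encodeRef (x : Fin n) : (encodeRef x).length = Nat.clog 2 n := by
  simp [encodeRef]

theorem length_encodePlan (plan : List (Fin n × Fin n)) :
    (encodePlan plan).length = plan.length * (2 * Nat.clog 2 n) := by
  simp [encodePlan, List.length_flatMap, length_encodeRef, two_mul]

theorem length_encodeInput (I : Instance n) :
    (encodeInput I).length = (∑ x, (I.nbrs x).length) * (Nat.clog 2 n + 1) + 3 * n := by
  have h : ∀ x, ((I.nbrs x).flatMap (fun y => true :: encodeRef y) ++
      [false, decide (x ∈ I.start), decide (x ∈ I.targets)]).length =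
      (I.nbrs x).length * (Nat.clog 2 n + 1) + 3 := by
    intro x
    simp [List.length_flatMap, length_encodeRef]
  rw [encodeInput, List.length_flatMap, Finset.sum_mul]
  simp only [h]
  rw [← List.sum_toFinset _ (List.nodup_finRange n), List.toFinset_finRange,
    Finset.sum_add_distrib]
  simp [mul_comm]

theorem sum_card_children (I : Instance n) (r : Fin n) :
    ∑ u, (I.children r u).card + 1 = n := by
  have := Instance.sum_sum_children (I := I) (r := r) fun _ => 1
  simp only [← Finset.card_eq_sum_ones] at this
  rw [this, Finset.card_erase_of_mem (Finset.mem_univ r), Finset.card_univ, Fintype.card_fin]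
  have := r.pos
  omega

/-- Counting each of the `n - 1` edges only at its upper node already suffices. -/
theorem le_sum_length_nbrs (I : Instance n) (r : Fin n) : n ≤ ∑ x, (I.nbrs x).length + 1 := by
  classical
  refine (sum_card_children I r).ge.trans (Nat.succ_le_succ (Finset.sum_le_sum fun u _ => ?_))
  rw [← List.toFinset_card_of_nodup (I.nodup_nbrs u)]
  refine Finset.card_le_card fun v hv => ?_
  rw [List.mem_toFinset, I.mem_nbrs]
  exact (Instance.mem_children.1 hv).adj

theorem sum_length_nbrs_le (I : Instance n) (r : Fin n) : ∑ x, (I.nbrs x).length ≤ 2 * n := by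
  have h : ∀ x, (I.nbrs x).length ≤ 1 + (I.children r x).card := fun x => by
    simpa using sum_nbrs_le (I := I) (r := r) x (fun _ => 1) 1
  refine (Finset.sum_le_sum fun x _ => h x).trans ?_
  rw [Finset.sum_add_distrib]
  have := sum_card_children I r
  simp only [Finset.sum_const, Finset.card_univ, Fintype.card_fin, smul_eq_mul]
  omega

theorem one_le_clog (hn : 2 ≤ n) : 1 ≤ Nat.clog 2 n := Nat.clog_pos (by norm_num) hn

theorem word_le (hn : 2 ≤ n) : word n ≤ 5 * Nat.clog 2 n := by
  have h1 := one_le_clog hn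
  have h2 : n ≤ 2 ^ Nat.clog 2 n := Nat.le_pow_clog (by norm_num) n
  have h3 : Nat.size (2 * n ^ 2) ≤ 2 * Nat.clog 2 n + 2 := by
    rw [Nat.size_le]
    calc 2 * n ^ 2 ≤ 2 * (2 ^ Nat.clog 2 n) ^ 2 := by gcongr
      _ = 2 ^ (2 * Nat.clog 2 n + 1) := by ring
      _ < 2 ^ (2 * Nat.clog 2 n + 2) := Nat.pow_lt_pow_right (by norm_num) (by omega)
  unfold word
  omega

/-- With `c = ⌈log₂ n⌉`, both `(c - 1) * log 2` and `log 2` are at most `log n`, so `c * log 2 ≤ 2 *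
log n`; the factor 4 follows from `log 2 > 1/2`. -/
theorem clog_le_log (hn : 2 ≤ n) : (Nat.clog 2 n : ℝ) ≤ 4 * Real.log n := by
  have h1 := one_le_clog hn
  have h2 : 2 ^ (Nat.clog 2 n - 1) < n := Nat.pow_pred_clog_lt_self (by norm_num) hn
  have h3 : ((Nat.clog 2 n - 1 : ℕ) : ℝ) * Real.log 2 ≤ Real.log n := by
    rw [← Real.log_pow]
    exact Real.log_le_log (by positivity) (by exact_mod_cast h2.le)
  have h4 : Real.log 2 ≤ Real.log n := Real.log_le_log (by norm_num) (by exact_mod_cast hn)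
  have h5 := Real.log_two_gt_d9
  rw [Nat.cast_sub h1, Nat.cast_one] at h3
  have h6 : (1 : ℝ) ≤ Nat.clog 2 n := by exact_mod_cast h1
  nlinarith

end UPMT

/-! ### The common constant -/

theorem mainTheorem2 :
    ∃ C : ℝ, 0 < C ∧ ∀ (n : ℕ) (_ : 2 ≤ n) (I : UPMT.Instance n) (r : Fin n),
      ∃ (plan : List (Fin n × Fin n)) (t : ℕ),
        UPMT.Runs I r plan t ∧
        I.Feasible plan ∧
        plan.length = I.opt ∧
        (t : ℝ) ≤ C * (n * Real.log n + I.opt * Real.log n) ∧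
        (t : ℝ) ≤ C * ((UPMT.encodeInput I).length + (UPMT.encodePlan plan).length) ∧
        ((UPMT.encodeInput I).length : ℝ) ≤ C * (n * Real.log n) ∧
        ((UPMT.encodePlan plan).length : ℝ) ≤ C * (I.opt * Real.log n) := by
  -- 2400 is 600 from `ht'` times 4 from `clog_le_log`; the other three bounds need less.
  refine ⟨2400, by norm_num, fun n hn I r => ?_⟩
  obtain ⟨plan, t, hruns, hfeas, hopt, ht⟩ := UPMT.exists_runs hn I r
  have hw := UPMT.word_le hn
  have hc := UPMT.one_le_clog hn
  have hlog := UPMT.clog_le_log hn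
  have hplan := UPMT.length_encodePlan plan
  have hinput := UPMT.length_encodeInput I
  have hlow := UPMT.le_sum_length_nbrs I r
  have hupp := UPMT.sum_length_nbrs_le I r
  rw [hopt] at hplan
  set c := Nat.clog 2 n
  set s := ∑ x, (I.nbrs x).length
  have ht' : t ≤ 500 * (c * n) + 600 * (c * I.opt) := by
    calc t ≤ 100 * UPMT.word n * n + 120 * UPMT.word n * I.opt := ht
      _ ≤ 100 * (5 * c) * n + 120 * (5 * c) * I.opt := by gcongr
      _ = _ := by ring
  -- This makes the running time linear in the encodings: the neighbour lists contain at least `n -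
  -- 1 ≥ n / 2` references of `c` bits each.
  have hin_low : c * n ≤ 2 * (UPMT.encodeInput I).length := by
    rw [hinput]
    have : n ≤ 2 * s := by omega
    nlinarith
  have hin_upp : (UPMT.encodeInput I).length ≤ 7 * (c * n) := by
    rw [hinput]
    nlinarith
  have hL : ∀ m : ℕ, ((c * m : ℕ) : ℝ) ≤ 4 * (m * Real.log n) := fun m => by
    rw [Nat.cast_mul]
    have := mul_le_mul_of_nonneg_right hlog (Nat.cast_nonneg (α := ℝ) m)
    linarith
  have hLn := hL n
  have hLo := hL I.opt
  have hn0 : (0 : ℝ) ≤ ((c * n : ℕ) : ℝ) := Nat.cast_nonneg _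
  have ho0 : (0 : ℝ) ≤ ((c * I.opt : ℕ) : ℝ) := Nat.cast_nonneg _
  refine ⟨plan, t, hruns, hfeas, hopt, ?_, ?_, ?_, ?_⟩
  · have : (t : ℝ) ≤ 500 * ((c * n : ℕ) : ℝ) + 600 * ((c * I.opt : ℕ) : ℝ) := by
      exact_mod_cast ht'
    linarith
  · have : t ≤ 2400 * ((UPMT.encodeInput I).length + (UPMT.encodePlan plan).length) := by
      have : (UPMT.encodePlan plan).length = 2 * (c * I.opt) := by rw [hplan]; ring
      omega
    exact_mod_cast this
  · have : ((UPMT.encodeInput I).length : ℝ) ≤ 7 * ((c * n : ℕ) : ℝ) := by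
      exact_mod_cast hin_upp
    linarith
  · have : ((UPMT.encodePlan plan).length : ℝ) = 2 * ((c * I.opt : ℕ) : ℝ) := by
      rw [hplan]; push_cast; ring
    linarith
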